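/- **Theorem (the smooth limit).** *Conventions.* A prespectral triple $(A,H)$ is a finite-dimensional unital $*$-algebra $A$ acting faithfully by a $*$-action $\lambda$ on a finite-dimensional Hilbert space $H$; a morphism $(\phi,L):(A,H)\to(A',H')$ is a $*$-algebra map $\phi:A\to A'$ with a unitary $L:H\to H'$ such that $\lambda'(\phi(x))=L\lambda(x)L^*$ for all $x \in A$. A representation of a quiver $Q$ assigns a prespectral triple $(A_v,H_v)$ to each vertex and a morphism $(\phi_e,L_e):(A_{s(e)},H_{s(e)})\to(A_{t(e)},H_{t(e)})$ to each edge. Given edge lengths $\rho(e)>0$, its Dirac operator on $\bigoplus_v H_v$ is $D=\sum_{e}\rho(e)^{-1}(L_e+L_e^*)$, where $L_e$ and $L_e^*$ are extended by zero. The quiver $O^d_m$ has the vertices $(\mathbb Z/m\mathbb Z)^d$, one edge from $v$ to $v+\mathbf e_j$ for each $v$ and each $j=1,\dots,d$, and one self-loop $o_v$ at each $v$; put $\varphi_v=\rho(o_v)^{-1}(L_{o_v}+L_{o_v}^*)$. Let $d\ge 2$, $N\ge 1$, $\ell>0$, and let $f(x)=\sum_{k=0}^4 f_kx^k$ be a real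 polynomial. Let $h,A_1,\dots,A_d$ be smooth hermitian $M_N(\mathbb C)$-valued fields on the torus $\mathbb T^d=\mathbb R^d/(\ell\mathbb Z)^d$, of volume $\ell^d$. For $m\geq 1$ let $a=\ell/m$ be the lattice spacing, $\Lambda=1/a$, and identify the vertex $v$ of $O^d_m$ with the point $av\in\mathbb T^d$. Let $R$ be a representation of $O^d_m$ in prespectral triples with $(A_{v_0},H_{v_0})\cong(M_N(\mathbb C),\mathbb C^N)$ for some vertex $v_0$. Then $(A_v,H_v)\cong(M_N(\mathbb C),\mathbb C^N)$ for every vertex $v$. Suppose further that $\rho=a$ on the edges that are not self-loops, that $\rho(o_v)>0$ is arbitrary, and that in suitable orthonormal frames $H_v\cong\mathbb C^N$ one has $\varphi_v=h(av)$ and the block of $aD$ which the edge $e=(v,v+\mathbf e_j)$ contributes from $H_{v+\mathbf e_j}$ to $H_v$ (that is, $L_e^*$) is $\exp(\mathrm i aA_j(av))$. Then, as $m\to\infty$, i.e. $a\to0^+$, $$\begin{aligned}\operatorname{Tr} f(D/\Lambda)={}&\Lambda^{d}N\,[f_0+2d f_2+(12d^2-6d)f_4]\operatorname{vol}(\mathbb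 T^d)-2\Lambda^{d-4}f_4\int_{\mathbb T^d}\sum_{i,j=1}^d\operatorname{Tr}_N(F_{ij}^2)\,d^dx\\&-\int_{\mathbb T^d}\operatorname{Tr}_N\Big\{2\Lambda^{d-4}f_4\sum_{j=1}^d(D_jh)^2-\Lambda^{d-2}(f_2+12d f_4)h^2-\Lambda^{d-4}f_4h^4\Big\}d^dx\\&+\int_{\mathbb T^d}\operatorname{Tr}_N\Big\{\Lambda^{d-1}(f_1+6d f_3)h+\Lambda^{d-3}f_3h^3\Big\}d^dx+O(\Lambda^{d-5}),\end{aligned}$$ where $D_jh=\partial_jh+[\mathrm iA_j,h]$ and $F_{ij}=\partial_iA_j-\partial_jA_i+\mathrm i[A_i,A_j]$. The constant in $O(\Lambda^{d-5})$ depends only on $d,N,\ell,f,h,A_1,\dots,A_d$, not on $m$ or on the representation $R$. (For even $f$, i.e. $f_1=f_3=0$, the last integral is absent.) -/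

import Mathlib

open CategoryTheory
open scoped ContDiff

noncomputable section

/-! ## Prespectral triples -/

/-- A prespectral triple `(A, λ, H)`: a finite-dimensional unital `*`-algebra `A` acting faithfully,
by a `*`-action `λ = act`, on a finite-dimensional Hilbert space `H`.
(The star of `Module.End ℂ H` is the adjoint.) -/
structure PrespectralTriple where
  A : Type
  H : Type
  [ring : Ring A]
  [algebra : Algebra ℂ A]
  [starRing : StarRing A]
  [starModule : StarModule ℂ A]
  [finAlg : FiniteDimensional ℂ A]
  [normed : NormedAddCommGroup H]
  [inner : InnerProductSpace ℂ H]
  [finHilb : FiniteDimensional ℂ H]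
  act : A →⋆ₐ[ℂ] Module.End ℂ H
  faithful : Function.Injective act

namespace PrespectralTriple

attribute [instance] ring algebra starRing starModule finAlg normed inner finHilb

/-- A morphism `(φ, L)`: a `*`-algebra map `φ` and a unitary `L` with `λ'(φ(a)) = L λ(a) L*`. -/
@[ext]
structure Hom (X Y : PrespectralTriple) where
  algMap : X.A →⋆ₐ[ℂ] Y.A
  trans : X.H ≃ₗᵢ[ℂ] Y.H
  compat : ∀ (a : X.A) (ψ : Y.H), Y.act (algMap a) ψ = trans (X.act a (trans.symm ψ))

instance : Category PrespectralTriple where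
  Hom := Hom
  id X :=
    { algMap := StarAlgHom.id ℂ X.A
      trans := LinearIsometryEquiv.refl ℂ X.H
      compat := fun _ _ => rfl }
  comp {X Y Z} S T :=
    { algMap := T.algMap.comp S.algMap
      trans := S.trans.trans T.trans
      compat := fun a ψ => by
        have h1 := T.compat (S.algMap a) ψ
        have h2 := S.compat a (T.trans.symm ψ)
        rw [h2] at h1
        exact h1 }
  id_comp _ := rfl
  comp_id _ := rfl
  assoc _ _ _ := rfl

/-- The prespectral triple `(M_N(ℂ), ℂ^N)`, matrices acting on column vectors. -/
def matrixTriple (N : ℕ) : PrespectralTriple where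
  A := Matrix (Fin N) (Fin N) ℂ
  H := EuclideanSpace ℂ (Fin N)
  act := ((LinearMap.toMatrixOrthonormal (EuclideanSpace.basisFun (Fin N) ℂ)).symm :
    Matrix (Fin N) (Fin N) ℂ →⋆ₐ[ℂ] Module.End ℂ (EuclideanSpace ℂ (Fin N)))
  faithful := (LinearMap.toMatrixOrthonormal (EuclideanSpace.basisFun (Fin N) ℂ)).symm.injective

end PrespectralTriple

/-! ## Quiver representations and their Dirac operator -/

/-- A representation of a quiver in prespectral triples: a triple `X_v` for each vertex and a
morphism `(φ_e, L_e) : X_{s(e)} ⟶ X_{t(e)}` for each edge. (By the universal property of the free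
category these are the functors from the path category to prespectral triples.) -/
abbrev QuiverRep (V : Type) [Quiver.{0} V] := V ⥤q PrespectralTriple

/-- Assignments of a length to each edge of a quiver (graph distances are the positive ones). -/
abbrev EdgeLength (V : Type) [Quiver.{0} V] := ∀ v w : V, (v ⟶ w) → ℝ

namespace QuiverRep

variable {V : Type} [Quiver.{0} V] (R : QuiverRep V) (ρ : EdgeLength V)

/-- The unitary `L_e : H_{s(e)} → H_{t(e)}`. -/
def link {v w : V} (e : v ⟶ w) : (R.obj v).H ≃ₗᵢ[ℂ] (R.obj w).H :=
  PrespectralTriple.Hom.trans (R.map e)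

/-- The weight `b_e = L_e / ρ(e)`. -/
def weight {v w : V} (e : v ⟶ w) : (R.obj v).H →ₗ[ℂ] (R.obj w).H :=
  ((ρ v w e : ℂ)⁻¹) • (R.link e).toLinearEquiv.toLinearMap

/-- The block `H_w → H_v` of the symmetrised weight matrix: the sum of `b_e` over the edges
`e : w → v` and of `b_e*` over the edges `e : v → w`. -/
def diracBlock [∀ v w : V, Fintype (v ⟶ w)] (v w : V) : (R.obj w).H →ₗ[ℂ] (R.obj v).H :=
  (∑ e : w ⟶ v, R.weight ρ e) + ∑ e : v ⟶ w, LinearMap.adjoint (R.weight ρ e)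

/-- The Dirac operator `D_Q(L, ρ)` on `⨁_v H_v` (a finite direct sum, hence the product). -/
def dirac [Fintype V] [∀ v w : V, Fintype (v ⟶ w)] : Module.End ℂ (∀ v, (R.obj v).H) :=
  LinearMap.pi fun v => ∑ w, (R.diracBlock ρ v w).comp (LinearMap.proj w)

end QuiverRep

/-- The spectral action `Tr f(D/Λ)` for a real polynomial `f`. -/
def spectralAction {E : Type} [AddCommGroup E] [Module ℂ E] (f : Polynomial ℝ)
    (D : Module.End ℂ E) (Λ : ℝ) : ℂ :=
  LinearMap.trace ℂ E (Polynomial.aeval ((Λ : ℂ)⁻¹ • D) (f.map (algebraMap ℝ ℂ)))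

/-! ## The lattice quivers -/

/-- The vertices `(ℤ/mℤ)^d` of the torus lattice. -/
def TorusLattice (d m : ℕ) : Type := Fin d → ZMod m

namespace TorusLattice

variable {d m : ℕ}

instance : DecidableEq (TorusLattice d m) := inferInstanceAs (DecidableEq (Fin d → ZMod m))

instance [NeZero m] : Fintype (TorusLattice d m) := inferInstanceAs (Fintype (Fin d → ZMod m))

/-- The neighbour `v + 𝐞_j`. -/
def shift (v : TorusLattice d m) (j : Fin d) : TorusLattice d m :=
  fun k => v k + if k = j then 1 else 0

/-- The quiver `T^d_m`: one edge from `v` to `v + 𝐞_j` for each vertex `v` and each direction `j`. -/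
instance : Quiver.{0} (TorusLattice d m) where
  Hom v w := {j : Fin d // v.shift j = w}

instance (v w : TorusLattice d m) : Fintype (v ⟶ w) :=
  inferInstanceAs (Fintype {j : Fin d // v.shift j = w})

/-- The edge `(v, v + 𝐞_j)`. -/
def edge (v : TorusLattice d m) (j : Fin d) : v ⟶ v.shift j := ⟨j, rfl⟩

/-- The point of the torus `ℝ^d / (a m ℤ)^d` at which the vertex `v` sits when the lattice spacing
is `a`. -/
def point (a : ℝ) (v : TorusLattice d m) : Fin d → ℝ := fun k => a * ((v k).val : ℝ)

end TorusLattice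

/-- The quiver `Q°`, obtained from a quiver `Q` by adding one self-loop `o_v` at each vertex.
It has the vertices of `Q`. -/
def WithLoops (V : Type) : Type := V

namespace WithLoops

variable {V : Type}

/-- A vertex of `Q`, seen as a vertex of `Q°`. -/
def of (v : V) : WithLoops V := v

/-- A vertex of `Q°`, seen as a vertex of `Q`. -/
def base (v : WithLoops V) : V := v

instance [DecidableEq V] : DecidableEq (WithLoops V) := inferInstanceAs (DecidableEq V)

instance [Fintype V] : Fintype (WithLoops V) := inferInstanceAs (Fintype V)

instance [Quiver.{0} V] : Quiver.{0} (WithLoops V) where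
  Hom v w := (v.base ⟶ w.base) ⊕ PLift (v = w)

instance [DecidableEq V] [Quiver.{0} V] [∀ v w : V, Fintype (v ⟶ w)] (v w : WithLoops V) :
    Fintype (v ⟶ w) :=
  inferInstanceAs (Fintype ((v.base ⟶ w.base) ⊕ PLift (v = w)))

/-- An edge of `Q`, seen as an edge of `Q°`. -/
def old [Quiver.{0} V] {v w : V} (e : v ⟶ w) : of v ⟶ of w := Sum.inl e

/-- The self-loop `o_v`. -/
def loop [Quiver.{0} V] (v : WithLoops V) : v ⟶ v := Sum.inr ⟨rfl⟩

end WithLoops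

/-- The quiver `O^d_m`: the torus lattice `T^d_m` with a self-loop at each vertex. -/
abbrev LoopedTorus (d m : ℕ) : Type := WithLoops (TorusLattice d m)

/-- The operator `φ_v = (L_{o_v} + L_{o_v}*) / ρ(o_v)` on `H_v`. -/
def QuiverRep.higgs {V : Type} [Quiver.{0} V] (R : QuiverRep (WithLoops V))
    (ρ : EdgeLength (WithLoops V)) (v : WithLoops V) : Module.End ℂ (R.obj v).H :=
  R.weight ρ (WithLoops.loop v) + LinearMap.adjoint (R.weight ρ (WithLoops.loop v))

/-! ## Matrix fields on the flat torus -/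

/-- `N × N`-matrix-valued functions on `ℝ^d`. -/
abbrev MatrixField (d N : ℕ) : Type := (Fin d → ℝ) → Matrix (Fin N) (Fin N) ℂ

/-- `h` is a smooth hermitian matrix field on the torus `ℝ^d / (ℓ ℤ)^d`. -/
structure IsTorusField {d N : ℕ} (ℓ : ℝ) (h : MatrixField d N) : Prop where
  smooth : ∀ p q, ContDiff ℝ ∞ fun x => h x p q
  periodic : ∀ x j, h (x + Pi.single j ℓ) = h x
  hermitian : ∀ x, (h x).IsHermitian

namespace MatrixField

variable {d N : ℕ}

/-- The partial derivative `∂_j h`, taken entrywise. -/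
def partialDeriv (j : Fin d) (h : MatrixField d N) : MatrixField d N := fun x =>
  Matrix.of fun p q => fderiv ℝ (fun y => h y p q) x (Pi.single j 1)

/-- The covariant derivative `D_j h = ∂_j h + [i A_j, h]`. -/
def covDeriv (A : Fin d → MatrixField d N) (j : Fin d) (h : MatrixField d N) : MatrixField d N :=
  fun x => partialDeriv j h x + Complex.I • (A j x * h x - h x * A j x)

/-- The field strength `F_ij = ∂_i A_j - ∂_j A_i + i [A_i, A_j]`. -/
def curvature (A : Fin d → MatrixField d N) (i j : Fin d) : MatrixField d N :=
  fun x => partialDeriv i (A j) x - partialDeriv j (A i) x +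
    Complex.I • (A i x * A j x - A j x * A i x)

/-- `∫_{𝕋^d} Tr_N (g) d^dx` over the torus of side `ℓ`, i.e. over its fundamental cube. -/
def integralTrace (ℓ : ℝ) (g : MatrixField d N) : ℂ :=
  ∫ x in Set.Icc (0 : Fin d → ℝ) (fun _ => ℓ), (g x).trace

end MatrixField

/-- The representation `R` of `O^d_m`, with lattice spacing `a`, carries the lattice gauge field and
the lattice Higgs field sampled from `A` and `h`, in orthonormal frames `u_v : H_v ≅ ℂ^N`.

`gauge` says that `exp (i a A_j(v))` is the matrix which the edge `(v, v + 𝐞_j)` contributes to the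
row `v` and the column `v + 𝐞_j` of `a D`. As an operator this block goes from the space at
`v + 𝐞_j` to the space at `v`, so it is `L_e* = L_e⁻¹`; with it, `exp (i a A_j(v)) h(v + 𝐞_j)
exp (- i a A_j(v))` is an operator at `v` and loops are traced in the order
`exp (i a A_i(v)) exp (i a A_j(v + 𝐞_i)) ⋯`. -/
structure IsLatticeSample {d m N : ℕ} (a : ℝ) (A : Fin d → MatrixField d N) (h : MatrixField d N)
    (R : QuiverRep (LoopedTorus d m)) (ρ : EdgeLength (LoopedTorus d m))
    (u : ∀ v, (R.obj v).H ≃ₗᵢ[ℂ] EuclideanSpace ℂ (Fin N)) : Prop where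
  /-- Edges of the lattice have length `a`. -/
  spacing : ∀ (v w : TorusLattice d m) (e : v ⟶ w), ρ _ _ (WithLoops.old e) = a
  /-- The self-loops have an arbitrary positive length. -/
  loop_pos : ∀ v : LoopedTorus d m, 0 < ρ v v (WithLoops.loop v)
  gauge : ∀ (v : TorusLattice d m) (j : Fin d) (ψ : EuclideanSpace ℂ (Fin N)),
    u (.of v) ((R.link (WithLoops.old (v.edge j))).symm ((u (.of (v.shift j))).symm ψ)) =
      Matrix.toEuclideanLin (NormedSpace.exp ((Complex.I * a) • A j (v.point a))) ψ
  higgs : ∀ (v : TorusLattice d m) (ψ : EuclideanSpace ℂ (Fin N)),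
    u (.of v) (R.higgs ρ (.of v) ((u (.of v)).symm ψ)) = Matrix.toEuclideanLin (h (v.point a)) ψ

end

/-! Since Λ = 1/a, the action is the trace of f(aD). In the given frames aD is a block matrix T + y
over (ℤ/m)^d, where T is the sum of 2d unitary hopping operators S_σ, one per signed direction, and
y is block diagonal with entries a·h (`IsLatticeSample.diracBlock`). The loop lengths enter only
through φ_v and drop out.

As deg f ≤ 4, only words of at most four letters matter, and for m ≥ 5 such a word has nonzero trace
only if its path already closes in ℤ^d. Backtracking paths give constants and powers of h. The
remaining words, plaquettes and S y S* y, are rewritten as squares of the commutators [S_i, S_j] and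
[S_j, y]. This gives an exact lattice identity, `blockTrace_aeval_latticeDirac`.

Commutator squares need only leading-order expansions: at a vertex [S_i, S_j] is i a² F_ij + O(a³)
and [S_j, y] is a² D_j h + O(a³), so their squares are a⁴ Tr F² and a⁴ Tr (Dh)² up to O(a⁵), instead
of an expansion of plaquettes to fourth order (`exists_trace_plaquetteDefect_le`,
`exists_trace_higgsDefect_le`). Summed over m^d = ℓ^d Λ^d vertices, these errors are O(Λ^(d-5)).

It remains to replace lattice sums by integrals. Riemann sums of smooth periodic functions are
accurate to O(a⁴) (`IsSmoothPeriodic.exists_riemannSum_le`), and every nonconstant term carries at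
least one more factor a.

The isomorphism claim is a dimension count: M_N(ℂ) is already all of End(ℂ^N), so a morphism out of
it must be an isomorphism, and directed paths join any two vertices of the torus. -/

/-! ## Riemann sums of periodic functions -/

/-- The trapezoidal rule with endpoint correction on an interval of length `a`. -/
theorem norm_integral_sub_corrected_trapezoid_le {g₀ g₁ g₂ g₃ g₄ : ℝ → ℂ} {K : ℝ}
    (h₀ : ∀ t, HasDerivAt g₀ (g₁ t) t) (h₁ : ∀ t, HasDerivAt g₁ (g₂ t) t)
    (h₂ : ∀ t, HasDerivAt g₂ (g₃ t) t) (h₃ : ∀ t, HasDerivAt g₃ (g₄ t) t)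
    (h₄ : Continuous g₄) (hK : ∀ t, ‖g₄ t‖ ≤ K) (b a : ℝ) (ha : 0 ≤ a) :
    ‖(∫ t in b..b + a, g₀ t) - ((a / 2) • (g₀ b + g₀ (b + a))
      - (a ^ 2 / 12) • (g₁ (b + a) - g₁ b))‖ ≤ K * a ^ 5 := by
  -- Peano kernel with fourth derivative 1. Its double zeros at both ends remove g₃ and g₂ from the
  -- boundary terms; p₂ = a²/12 and p₃ = ±a/2 there give exactly the corrected trapezoid.
  set p : ℝ → ℝ := fun t => (t - b) ^ 2 * (b + a - t) ^ 2 / 24 with hp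
  set p₁ : ℝ → ℝ := fun t => (t - b) * (b + a - t) * (a - 2 * (t - b)) / 12 with hp₁
  set p₂ : ℝ → ℝ := fun t => (a ^ 2 - 6 * a * (t - b) + 6 * (t - b) ^ 2) / 12 with hp₂
  set p₃ : ℝ → ℝ := fun t => (t - b) - a / 2 with hp₃
  have d₀ : ∀ t, HasDerivAt p (p₁ t) t := fun t => by
    have := ((((hasDerivAt_id t).sub_const b).pow 2).mul
      (((hasDerivAt_id t).const_sub (b + a)).pow 2)).div_const 24
    refine this.congr_deriv ?_
    simp [hp₁]; ring
  have d₁ : ∀ t, HasDerivAt p₁ (p₂ t) t := fun t => by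
    have := ((((hasDerivAt_id t).sub_const b).mul ((hasDerivAt_id t).const_sub (b + a))).mul
      ((((hasDerivAt_id t).sub_const b).const_mul 2).const_sub a)).div_const 12
    refine this.congr_deriv ?_
    simp [hp₂]; ring
  have d₂ : ∀ t, HasDerivAt p₂ (p₃ t) t := fun t => by
    have := (((((hasDerivAt_id t).sub_const b).const_mul (6 * a)).const_sub (a ^ 2)).add
      ((((hasDerivAt_id t).sub_const b).pow 2).const_mul 6)).div_const 12
    refine this.congr_deriv ?_
    simp [hp₃]; ring
  have d₃ : ∀ t, HasDerivAt p₃ 1 t := fun t => by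
    exact ((hasDerivAt_id t).sub_const b).sub_const (a / 2)
  set Φ : ℝ → ℂ := fun t => p t • g₃ t - p₁ t • g₂ t + p₂ t • g₁ t - p₃ t • g₀ t with hΦ
  have dΦ : ∀ t, HasDerivAt Φ (p t • g₄ t - g₀ t) t := fun t => by
    have := ((((d₀ t).smul (h₃ t)).sub ((d₁ t).smul (h₂ t))).add ((d₂ t).smul (h₁ t))).sub
      ((d₃ t).smul (h₀ t))
    refine this.congr_deriv ?_
    simp only [one_smul]; abel
  have cg₀ : Continuous g₀ := continuous_iff_continuousAt.2 fun t => (h₀ t).continuousAt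
  have cp : Continuous p := continuous_iff_continuousAt.2 fun t => (d₀ t).continuousAt
  have c₁ : Continuous fun t => p t • g₄ t := cp.smul h₄
  have key := intervalIntegral.integral_eq_sub_of_hasDerivAt (a := b) (b := b + a)
    (fun t _ => dΦ t) ((c₁.sub cg₀).intervalIntegrable _ _)
  rw [intervalIntegral.integral_sub (c₁.intervalIntegrable _ _)
    (cg₀.intervalIntegrable _ _)] at key
  have hend : (∫ t in b..b + a, g₀ t) - ((a / 2) • (g₀ b + g₀ (b + a))
      - (a ^ 2 / 12) • (g₁ (b + a) - g₁ b)) = ∫ t in b..b + a, p t • g₄ t := by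
    have e : (∫ t in b..b + a, g₀ t) = (∫ t in b..b + a, p t • g₄ t) - (Φ (b + a) - Φ b) := by
      rw [← key]; ring
    rw [e]
    simp [hΦ, hp, hp₁, hp₂, hp₃]
    ring
  rw [hend]
  have hb : ∀ t ∈ Set.uIoc b (b + a), ‖p t • g₄ t‖ ≤ a ^ 4 * K := fun t ht => by
    rw [Set.uIoc_of_le (by linarith)] at ht
    have h1 : 0 ≤ t - b := by linarith [ht.1]
    have h2 : 0 ≤ b + a - t := by linarith [ht.2]
    have h3 : (t - b) ^ 2 ≤ a ^ 2 := by gcongr; linarith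
    have h4 : (b + a - t) ^ 2 ≤ a ^ 2 := by gcongr; linarith
    rw [norm_smul, Real.norm_of_nonneg (by positivity)]
    have h5 : p t ≤ a ^ 4 := by
      have : (t - b) ^ 2 * (b + a - t) ^ 2 ≤ a ^ 2 * a ^ 2 := by gcongr
      have h6 : 0 ≤ a ^ 4 := by positivity
      simp only [hp]; nlinarith
    exact mul_le_mul h5 (hK t) (norm_nonneg _) (by positivity)
  refine (intervalIntegral.norm_integral_le_of_norm_le_const hb).trans (le_of_eq ?_)
  rw [add_sub_cancel_left, abs_of_nonneg ha]; ring

/-- Summing the corrected trapezoid over the cells, the differences of g₀ and of g₁ telescope to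
zero by periodicity, which leaves the left-endpoint sum. The m cell errors K a⁵ add up to ℓ K a⁴. -/
theorem norm_riemannSum_sub_integral_le {g₀ g₁ g₂ g₃ g₄ : ℝ → ℂ} {K : ℝ}
    (h₀ : ∀ t, HasDerivAt g₀ (g₁ t) t) (h₁ : ∀ t, HasDerivAt g₁ (g₂ t) t)
    (h₂ : ∀ t, HasDerivAt g₂ (g₃ t) t) (h₃ : ∀ t, HasDerivAt g₃ (g₄ t) t)
    (h₄ : Continuous g₄) (hK : ∀ t, ‖g₄ t‖ ≤ K) {a ℓ : ℝ} {m : ℕ} (ha : 0 ≤ a)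
    (ham : a * m = ℓ) (p₀ : g₀ ℓ = g₀ 0) (p₁ : g₁ ℓ = g₁ 0) :
    ‖a • ∑ k ∈ Finset.range m, g₀ (a * k) - ∫ t in (0 : ℝ)..ℓ, g₀ t‖ ≤ ℓ * K * a ^ 4 := by
  have cg₀ : Continuous g₀ := continuous_iff_continuousAt.2 fun t => (h₀ t).continuousAt
  have hsum := intervalIntegral.sum_integral_adjacent_intervals (f := g₀) (a := fun k : ℕ => a * k)
    (n := m) (μ := MeasureTheory.volume) (fun k _ => cg₀.intervalIntegrable _ _)
  have t₀ := Finset.sum_range_sub (fun k : ℕ => g₀ (a * k)) m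
  have t₁ := Finset.sum_range_sub (fun k : ℕ => g₁ (a * k)) m
  simp only [Nat.cast_zero, mul_zero, ham, p₀, p₁, sub_self] at t₀ t₁ hsum
  have e : a • ∑ k ∈ Finset.range m, g₀ (a * k) - ∫ t in (0 : ℝ)..ℓ, g₀ t =
      - ∑ k ∈ Finset.range m, ((∫ t in a * k..a * k + a, g₀ t) -
        ((a / 2) • (g₀ (a * k) + g₀ (a * k + a)) - (a ^ 2 / 12) • (g₁ (a * k + a) - g₁ (a * k)))) := by
    have hk : ∀ k : ℕ, a * k + a = a * (k + 1 : ℕ) := fun k => by push_cast; ring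
    simp only [hk]
    have hk2 : ∀ k : ℕ, g₀ (a * k) + g₀ (a * (k + 1 : ℕ)) =
        (g₀ (a * (k + 1 : ℕ)) - g₀ (a * k)) + (2 : ℝ) • g₀ (a * k) := fun k => by
      simp [two_mul]; ring
    simp only [hk2]
    rw [Finset.sum_sub_distrib, Finset.sum_sub_distrib, hsum, ← Finset.smul_sum,
      ← Finset.smul_sum, t₁, Finset.sum_add_distrib, t₀, ← Finset.smul_sum, smul_zero, zero_add,
      sub_zero, smul_smul]
    rw [show a / 2 * 2 = a by ring]; ring
  rw [e, norm_neg]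
  refine (norm_sum_le_of_le _ fun (k : ℕ) _ =>
    norm_integral_sub_corrected_trapezoid_le h₀ h₁ h₂ h₃ h₄ hK (a * (k : ℝ)) a ha).trans (le_of_eq ?_)
  rw [Finset.sum_const, Finset.card_range, nsmul_eq_mul, ← ham]; ring

theorem ZMod.sum_val_eq_sum_range {M : Type*} [AddCommMonoid M] (m : ℕ) [NeZero m] (g : ℕ → M) :
    ∑ k : ZMod m, g k.val = ∑ k ∈ Finset.range m, g k := by
  obtain ⟨n, rfl⟩ := Nat.exists_eq_succ_of_ne_zero (NeZero.ne m)
  exact Fin.sum_univ_eq_sum_range g (n + 1)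

open MeasureTheory in
theorem setIntegral_Icc_pi_succ {d : ℕ} {G : (Fin (d + 1) → ℝ) → ℂ} (hG : Continuous G) (ℓ : ℝ)
    (hℓ : 0 ≤ ℓ) :
    ∫ x in Set.Icc (0 : Fin (d + 1) → ℝ) (fun _ => ℓ), G x =
      ∫ y in Set.Icc (0 : Fin d → ℝ) (fun _ => ℓ), ∫ t in (0 : ℝ)..ℓ, G (Fin.cons t y) := by
  set e : ℝ × (Fin d → ℝ) ≃ᵐ (Fin (d + 1) → ℝ) :=
    (MeasurableEquiv.piFinSuccAbove (fun _ => ℝ) 0).symm with he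
  have hem : MeasurePreserving e :=
    (volume_preserving_piFinSuccAbove (fun _ : Fin (d + 1) => ℝ) 0).symm _
  have hpre : (e ⁻¹' Set.Icc 0 fun _ => ℓ) =
      Set.Icc 0 ℓ ×ˢ Set.Icc (0 : Fin d → ℝ) fun _ => ℓ :=
    ((Fin.insertNthOrderIso (fun _ => ℝ) 0).preimage_Icc _ _).trans (Set.Icc_prod_eq _ _)
  have hcons : ∀ t y, e (t, y) = Fin.cons t y := fun t y => by
    simp [he, MeasurableEquiv.piFinSuccAbove_symm_apply, Fin.insertNthEquiv]
  have hc : Continuous fun z : ℝ × (Fin d → ℝ) => G (Fin.cons z.1 z.2) := by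
    refine hG.comp (continuous_pi fun i => ?_)
    refine Fin.cases ?_ (fun j => ?_) i
    · simpa using continuous_fst
    · simp only [Fin.cons_succ]; fun_prop
  have hint : IntegrableOn (fun z : ℝ × (Fin d → ℝ) => G (Fin.cons z.1 z.2))
      (Set.Icc 0 ℓ ×ˢ Set.Icc (0 : Fin d → ℝ) fun _ => ℓ) (volume.prod volume) :=
    hc.continuousOn.integrableOn_compact (isCompact_Icc.prod isCompact_Icc)
  rw [← hem.map_eq, setIntegral_map_equiv, hpre, Measure.volume_eq_prod]
  have : ∀ z : ℝ × (Fin d → ℝ), G (e z) = G (Fin.cons z.1 z.2) := fun z => by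
    rw [← hcons]
  simp only [this]
  rw [← Measure.prod_restrict, integral_prod_symm _ (by rwa [Measure.prod_restrict])]
  refine setIntegral_congr_fun measurableSet_Icc fun y _ => ?_
  simp only
  rw [intervalIntegral.integral_of_le hℓ, integral_Icc_eq_integral_Ioc]

open MeasureTheory in
/-- A Riemann sum over a cubic lattice is accurate if it is accurate in every coordinate. -/
theorem norm_pi_riemannSum_sub_integral_le {a ℓ ε : ℝ} {m : ℕ} [NeZero m] (ha : 0 ≤ a)
    (ham : a * m = ℓ) (hε : 0 ≤ ε) : ∀ {d : ℕ} {G : (Fin d → ℝ) → ℂ}, Continuous G →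
    (∀ x j, ‖a • ∑ k : ZMod m, G (Function.update x j (a * k.val)) -
      ∫ t in (0 : ℝ)..ℓ, G (Function.update x j t)‖ ≤ ε) →
    ‖a ^ d • ∑ v : Fin d → ZMod m, G (fun k => a * (v k).val) -
      ∫ x in Set.Icc (0 : Fin d → ℝ) (fun _ => ℓ), G x‖ ≤ d * (1 + ℓ) ^ d * ε := by
  intro d
  induction d with
  | zero =>
    intro G hG h
    have h0 : (0 : Fin 0 → ℝ) = fun _ => ℓ := Subsingleton.elim _ _
    have h1 : ∀ v : Fin 0 → ZMod m, (fun k => a * ((v k).val : ℝ)) = (fun _ : Fin 0 => ℓ) :=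
      fun v => Subsingleton.elim _ _
    have h2 : (volume : Measure (Fin 0 → ℝ)) = Measure.dirac (fun _ => ℓ) := by
      rw [volume_pi, Measure.pi_of_empty _ (fun _ => ℓ)]
    simp only [h0, h1, h2]
    simp
  | succ d IH =>
    intro G hG h
    have hℓ : 0 ≤ ℓ := ham ▸ by positivity
    have hcons : ∀ k w, (fun i => a * (((Fin.cons k w : Fin (d + 1) → ZMod m) i).val : ℝ)) =
        Fin.cons (a * (k.val : ℝ)) (fun i => a * ((w i).val : ℝ)) := fun k w => by
      funext i; refine Fin.cases ?_ (fun j => ?_) i <;> simp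
    have hGc : ∀ t : ℝ, Continuous fun y : Fin d → ℝ => G (Fin.cons t y) := fun t =>
      hG.comp (continuous_pi fun i => by
        refine Fin.cases ?_ (fun j => ?_) i
        · simpa using continuous_const
        · simpa using continuous_apply j)
    have ih : ∀ t : ℝ, ‖a ^ d • ∑ w : Fin d → ZMod m, G (Fin.cons t (fun k => a * ((w k).val : ℝ))) -
        ∫ y in Set.Icc (0 : Fin d → ℝ) (fun _ => ℓ), G (Fin.cons t y)‖ ≤
          d * (1 + ℓ) ^ d * ε := fun t => by
      refine @IH (fun y => G (Fin.cons t y)) (hGc t) fun y j => ?_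
      have e : ∀ s : ℝ, Function.update (Fin.cons t y : Fin (d + 1) → ℝ) j.succ s =
          Fin.cons t (Function.update y j s) := fun s => (Fin.cons_update (α := fun _ => ℝ) t y j s).symm
      have := h (Fin.cons t y : Fin (d + 1) → ℝ) j.succ
      simp only [e] at this
      exact this
    have hsum : ∑ v : Fin (d + 1) → ZMod m, G (fun k => a * (v k).val) =
        ∑ k : ZMod m, ∑ w : Fin d → ZMod m,
          G (Fin.cons (a * (k.val : ℝ)) (fun i => a * ((w i).val : ℝ))) := by
      rw [← (Fin.consEquiv fun _ => ZMod m).sum_comp, Fintype.sum_prod_type]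
      refine Finset.sum_congr rfl fun k _ => Finset.sum_congr rfl fun w _ => ?_
      rw [← hcons]; rfl
    have hI : a • ∑ k : ZMod m, ∫ y in Set.Icc (0 : Fin d → ℝ) (fun _ => ℓ),
          G (Fin.cons (a * (k.val : ℝ)) y) =
        ∫ y in Set.Icc (0 : Fin d → ℝ) (fun _ => ℓ),
          a • ∑ k : ZMod m, G (Fin.cons (a * (k.val : ℝ)) y) := by
      rw [integral_smul, integral_finsetSum]
      exact fun k _ => (hGc _).continuousOn.integrableOn_compact isCompact_Icc
    have hpt : ∀ y : Fin d → ℝ, ‖a • ∑ k : ZMod m, G (Fin.cons (a * (k.val : ℝ)) y) -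
        ∫ t in (0 : ℝ)..ℓ, G (Fin.cons t y)‖ ≤ ε := fun y => by
      have e : ∀ s : ℝ, Function.update (Fin.cons 0 y : Fin (d + 1) → ℝ) 0 s = Fin.cons s y :=
        fun s => Fin.update_cons_zero (α := fun _ => ℝ) 0 y s
      have := h (Fin.cons 0 y : Fin (d + 1) → ℝ) 0
      simp only [e] at this
      exact this
    have hcI : Continuous fun y : Fin d → ℝ => ∫ t in (0 : ℝ)..ℓ, G (Fin.cons t y) := by
      refine intervalIntegral.continuous_parametric_intervalIntegral_of_continuous' ?_ 0 ℓ
      refine hG.comp (continuous_pi fun i => ?_)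
      refine Fin.cases ?_ (fun j => ?_) i
      · simpa using continuous_snd
      · simp only [Fin.cons_succ]; fun_prop
    have hcS : Continuous fun y : Fin d → ℝ => a • ∑ k : ZMod m, G (Fin.cons (a * (k.val : ℝ)) y) :=
      (continuous_finsetSum _ fun k _ => hGc _).const_smul a
    rw [setIntegral_Icc_pi_succ hG ℓ hℓ, hsum]
    -- The first summand discretises the last d coordinates at each lattice value of the first; the
    -- second discretises the first coordinate under the integral. They cost ℓ times the previous
    -- bound and ε ℓ^d.
    have split : a ^ (d + 1) • ∑ k : ZMod m, ∑ w : Fin d → ZMod m,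
          G (Fin.cons (a * (k.val : ℝ)) (fun i => a * ((w i).val : ℝ))) -
        ∫ y in Set.Icc (0 : Fin d → ℝ) (fun _ => ℓ), ∫ t in (0 : ℝ)..ℓ, G (Fin.cons t y) =
        a • ∑ k : ZMod m, (a ^ d • ∑ w : Fin d → ZMod m,
            G (Fin.cons (a * (k.val : ℝ)) (fun i => a * ((w i).val : ℝ))) -
          ∫ y in Set.Icc (0 : Fin d → ℝ) (fun _ => ℓ), G (Fin.cons (a * (k.val : ℝ)) y)) +
        ∫ y in Set.Icc (0 : Fin d → ℝ) (fun _ => ℓ),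
          (a • ∑ k : ZMod m, G (Fin.cons (a * (k.val : ℝ)) y) -
            ∫ t in (0 : ℝ)..ℓ, G (Fin.cons t y)) := by
      rw [integral_sub (hcS.continuousOn.integrableOn_compact isCompact_Icc)
        (hcI.continuousOn.integrableOn_compact isCompact_Icc), ← hI, Finset.sum_sub_distrib,
        smul_sub, ← Finset.smul_sum, smul_smul, pow_succ']
      ring
    rw [split]
    have b₁ : ‖a • ∑ k : ZMod m, (a ^ d • ∑ w : Fin d → ZMod m,
            G (Fin.cons (a * (k.val : ℝ)) (fun i => a * ((w i).val : ℝ))) -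
          ∫ y in Set.Icc (0 : Fin d → ℝ) (fun _ => ℓ), G (Fin.cons (a * (k.val : ℝ)) y))‖ ≤
        ℓ * (d * (1 + ℓ) ^ d * ε) := by
      rw [norm_smul, Real.norm_of_nonneg ha]
      refine (mul_le_mul_of_nonneg_left (norm_sum_le_of_le _ fun (k : ZMod m) _ =>
        ih (a * (k.val : ℝ))) ha).trans (le_of_eq ?_)
      rw [Finset.sum_const, Finset.card_univ, ZMod.card, nsmul_eq_mul, ← mul_assoc, ham]
    have b₂ : ‖∫ y in Set.Icc (0 : Fin d → ℝ) (fun _ => ℓ),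
          (a • ∑ k : ZMod m, G (Fin.cons (a * (k.val : ℝ)) y) -
            ∫ t in (0 : ℝ)..ℓ, G (Fin.cons t y))‖ ≤ ε * ℓ ^ d := by
      refine (norm_setIntegral_le_of_norm_le_const isCompact_Icc.measure_lt_top
        fun y _ => hpt y).trans (le_of_eq ?_)
      rw [measureReal_def, Real.volume_Icc_pi_toReal (a := 0) (fun _ => hℓ)]
      simp
    have h1 : ℓ ^ d ≤ (1 + ℓ) ^ d := by gcongr; linarith
    have h2 : 0 ≤ (1 + ℓ) ^ d := by positivity
    refine (norm_add_le _ _).trans ((add_le_add b₁ b₂).trans ?_)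
    have h3 : 0 ≤ (d : ℝ) * (1 + ℓ) ^ d * ε := by positivity
    have h4 : ε * ℓ ^ d ≤ ε * (1 + ℓ) ^ d := by gcongr
    have h5 : 0 ≤ ℓ * (ε * (1 + ℓ) ^ d) := by positivity
    push_cast
    calc _ ≤ ℓ * (d * (1 + ℓ) ^ d * ε) + ε * (1 + ℓ) ^ d := by gcongr
      _ ≤ _ := by rw [pow_succ]; linarith

/-! ## Smooth periodic functions -/

/-- Smooth complex functions on the torus `ℝ^d / (ℓ ℤ)^d`. -/
structure IsSmoothPeriodic {d : ℕ} (ℓ : ℝ) (G : (Fin d → ℝ) → ℂ) : Prop where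
  smooth : ContDiff ℝ ∞ G
  periodic : ∀ j, Function.Periodic G (Pi.single j ℓ)

/-- The partial derivative of a scalar function. -/
noncomputable def scalarPartial {d : ℕ} (j : Fin d) (G : (Fin d → ℝ) → ℂ) (x : Fin d → ℝ) : ℂ :=
  fderiv ℝ G x (Pi.single j 1)

namespace IsSmoothPeriodic

variable {d : ℕ} {ℓ : ℝ} {G H : (Fin d → ℝ) → ℂ}

theorem const (c : ℂ) : IsSmoothPeriodic (d := d) ℓ fun _ => c :=
  ⟨contDiff_const, fun _ _ => rfl⟩

theorem add (hG : IsSmoothPeriodic ℓ G) (hH : IsSmoothPeriodic ℓ H) :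
    IsSmoothPeriodic ℓ fun x => G x + H x :=
  ⟨hG.smooth.add hH.smooth, fun j x => by
    simp only [hG.periodic j x, hH.periodic j x]⟩

theorem mul (hG : IsSmoothPeriodic ℓ G) (hH : IsSmoothPeriodic ℓ H) :
    IsSmoothPeriodic ℓ fun x => G x * H x :=
  ⟨hG.smooth.mul hH.smooth, fun j x => by
    simp only [hG.periodic j x, hH.periodic j x]⟩

theorem sub (hG : IsSmoothPeriodic ℓ G) (hH : IsSmoothPeriodic ℓ H) :
    IsSmoothPeriodic ℓ fun x => G x - H x :=
  ⟨hG.smooth.sub hH.smooth, fun j x => by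
    simp only [hG.periodic j x, hH.periodic j x]⟩

theorem sum {ι : Type*} {s : Finset ι} {G : ι → (Fin d → ℝ) → ℂ}
    (hG : ∀ i, IsSmoothPeriodic ℓ (G i)) : IsSmoothPeriodic ℓ fun x => ∑ i ∈ s, G i x :=
  ⟨ContDiff.sum fun i _ => (hG i).smooth, fun j x => by
    simp only [fun i => (hG i).periodic j x]⟩

theorem scalarPartial (hG : IsSmoothPeriodic ℓ G) (j : Fin d) :
    IsSmoothPeriodic ℓ (scalarPartial j G) := by
  refine ⟨(hG.smooth.fderiv_right (m := ∞) (by simp)).clm_apply contDiff_const, fun k x => ?_⟩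
  have : (fun y => G (y + Pi.single k ℓ)) = G := funext (hG.periodic k)
  unfold _root_.scalarPartial
  have h := fderiv_comp_add_right (𝕜 := ℝ) (f := G) (x := x) (Pi.single k ℓ)
  rw [this] at h
  rw [← h]

theorem continuous (hG : IsSmoothPeriodic ℓ G) : Continuous G := hG.smooth.continuous

theorem exists_norm_le (hℓ : 0 < ℓ) (hG : IsSmoothPeriodic ℓ G) : ∃ K, 0 ≤ K ∧ ∀ x, ‖G x‖ ≤ K := by
  obtain ⟨K, hK⟩ := (isCompact_Icc (a := (0 : Fin d → ℝ)) (b := fun _ => ℓ)).exists_bound_of_continuousOn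
    hG.continuous.continuousOn
  have key : ∀ x, ‖G x‖ ≤ K := fun x => by
    have hper : ∀ n : Fin d → ℤ, Function.Periodic G (∑ j, n j • Pi.single j ℓ) := fun n =>
      Finset.sum_induction _ (fun c => Function.Periodic G c) (fun _ _ h₁ h₂ => h₁.add_period h₂)
        (fun y => by simp) (fun j _ => (hG.periodic j).zsmul (n j))
    have hx : x = (fun j => toIcoMod hℓ 0 (x j)) +
        ∑ j, toIcoDiv hℓ 0 (x j) • (Pi.single j ℓ : Fin d → ℝ) := by
      funext k
      simp only [Pi.add_apply, Finset.sum_apply, Pi.smul_apply, Pi.single_apply, smul_ite, smul_zero,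
        Finset.sum_ite_eq, Finset.mem_univ, if_true]
      exact (toIcoMod_add_toIcoDiv_zsmul hℓ 0 (x k)).symm
    rw [hx, hper]
    have hm : ∀ j, toIcoMod hℓ 0 (x j) ∈ Set.Ico 0 ℓ := fun j => by
      simpa using toIcoMod_mem_Ico hℓ 0 (x j)
    exact hK _ ⟨fun j => (hm j).1, fun j => (hm j).2.le⟩
  exact ⟨K, (norm_nonneg _).trans (key 0), key⟩

theorem hasDerivAt_update (hG : IsSmoothPeriodic ℓ G) (j : Fin d) (x : Fin d → ℝ) (t : ℝ) :
    HasDerivAt (fun s => G (Function.update x j s))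
      (_root_.scalarPartial j G (Function.update x j t)) t :=
  ((hG.smooth.differentiable (by simp)) (Function.update x j t)).hasFDerivAt.comp_hasDerivAt t
    (_root_.hasDerivAt_update x j t)

theorem update_side (hG : IsSmoothPeriodic ℓ G) (j : Fin d) (x : Fin d → ℝ) :
    G (Function.update x j ℓ) = G (Function.update x j 0) := by
  rw [← hG.periodic j (Function.update x j 0)]
  congr 1
  funext k
  by_cases hk : k = j
  · subst hk; simp
  · simp [hk]

/-- The constant comes from suprema of the pure fourth partial derivatives, hence is independent of
m. Order four is what the term linear in h requires, as it carries only one factor a of its own. -/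
theorem exists_riemannSum_le (hℓ : 0 < ℓ) (hG : IsSmoothPeriodic ℓ G) :
    ∃ C, 0 ≤ C ∧ ∀ (m : ℕ) [NeZero m] (a : ℝ), a * m = ℓ →
      ‖a ^ d • ∑ v : Fin d → ZMod m, G (fun k => a * (v k).val) -
        ∫ x in Set.Icc (0 : Fin d → ℝ) (fun _ => ℓ), G x‖ ≤ C * a ^ 4 := by
  choose K hK0 hK using fun j => ((((hG.scalarPartial j).scalarPartial j).scalarPartial
    j).scalarPartial j).exists_norm_le hℓ
  have hS : 0 ≤ ∑ j, K j := Finset.sum_nonneg fun j _ => hK0 j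
  refine ⟨d * (1 + ℓ) ^ d * (ℓ * ∑ j, K j), by positivity, fun m _ a ham => ?_⟩
  have hm : (0 : ℝ) < m := Nat.cast_pos.2 (NeZero.pos m)
  have ha : 0 ≤ a := by
    have : 0 < a * m := ham ▸ hℓ
    exact (pos_of_mul_pos_left this hm.le).le
  refine (norm_pi_riemannSum_sub_integral_le ha ham (ε := ℓ * (∑ j, K j) * a ^ 4) (by positivity)
    hG.continuous fun x j => ?_).trans (le_of_eq (by ring))
  rw [ZMod.sum_val_eq_sum_range m fun k => G (Function.update x j (a * k))]
  refine (norm_riemannSum_sub_integral_le (fun t => hG.hasDerivAt_update j x t)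
    (fun t => (hG.scalarPartial j).hasDerivAt_update j x t)
    (fun t => ((hG.scalarPartial j).scalarPartial j).hasDerivAt_update j x t)
    (fun t => (((hG.scalarPartial j).scalarPartial j).scalarPartial j).hasDerivAt_update j x t)
    ?_ (fun t => hK j _) ha ham (hG.update_side j x) ((hG.scalarPartial j).update_side j x)).trans ?_
  · exact ((((hG.scalarPartial j).scalarPartial j).scalarPartial j).scalarPartial
      j).continuous.comp (continuous_const.update j continuous_id)
  · have : K j ≤ ∑ j, K j := Finset.single_le_sum (fun j _ => hK0 j) (Finset.mem_univ j)
    gcongr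

/-- The first-order Taylor estimate in a coordinate direction. -/
theorem exists_taylor_le (hℓ : 0 < ℓ) (hG : IsSmoothPeriodic ℓ G) (j : Fin d) :
    ∃ K, 0 ≤ K ∧ ∀ (x : Fin d → ℝ) (a : ℝ), 0 ≤ a →
      ‖G (x + Pi.single j a) - G x - a * _root_.scalarPartial j G x‖ ≤ K * a ^ 2 := by
  obtain ⟨K, hK0, hK⟩ := ((hG.scalarPartial j).scalarPartial j).exists_norm_le hℓ
  refine ⟨K, hK0, fun x a ha => ?_⟩
  have hu : ∀ t, Function.update x j (x j + t) = x + Pi.single j t := fun t => by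
    funext k
    by_cases hk : k = j
    · subst hk; simp
    · simp [hk]
  have d₀ : ∀ t, HasDerivAt (fun t => G (x + Pi.single j t))
      (_root_.scalarPartial j G (x + Pi.single j t)) t := fun t => by
    have := (hG.hasDerivAt_update j x (x j + t)).comp_const_add (x j) t
    simpa only [hu] using this
  have d₁ : ∀ t, HasDerivAt (fun t => _root_.scalarPartial j G (x + Pi.single j t))
      (_root_.scalarPartial j (_root_.scalarPartial j G) (x + Pi.single j t)) t := fun t => by
    have := ((hG.scalarPartial j).hasDerivAt_update j x (x j + t)).comp_const_add (x j) t
    simpa only [hu] using this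
  -- The mean value inequality is used twice, here for the partial derivative and then for the
  -- Taylor remainder; this yields K rather than K/2.
  have b₁ : ∀ t ∈ Set.Icc 0 a,
      ‖_root_.scalarPartial j G (x + Pi.single j t) - _root_.scalarPartial j G x‖ ≤ K * a := by
    intro t ht
    have := (convex_Icc 0 a).norm_image_sub_le_of_norm_hasDerivWithin_le
      (fun s _ => (d₁ s).hasDerivWithinAt) (fun s _ => hK _) (Set.left_mem_Icc.2 ha) ht
    simp only [Pi.single_zero, add_zero, sub_zero] at this
    rw [Real.norm_of_nonneg ht.1] at this
    exact this.trans (by gcongr; exact ht.2)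
  have d₂ : ∀ t : ℝ, HasDerivAt
      (fun t : ℝ => G (x + Pi.single j t) - (t : ℂ) * _root_.scalarPartial j G x)
      (_root_.scalarPartial j G (x + Pi.single j t) - _root_.scalarPartial j G x) t := fun t => by
    have := (d₀ t).sub ((Complex.ofRealCLM.hasDerivAt (x := t)).mul_const
      (_root_.scalarPartial j G x))
    exact this.congr_deriv (by simp)
  have := (convex_Icc 0 a).norm_image_sub_le_of_norm_hasDerivWithin_le
      (fun s _ => (d₂ s).hasDerivWithinAt) b₁ (Set.left_mem_Icc.2 ha) (Set.right_mem_Icc.2 ha)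
  simp only [Pi.single_zero, add_zero, sub_zero, Complex.ofReal_zero, zero_mul] at this
  rw [Real.norm_of_nonneg ha] at this
  rw [sub_right_comm]
  exact this.trans (le_of_eq (by ring))

end IsSmoothPeriodic

/-! ## Expansions in the lattice spacing -/

section Expansion

open Asymptotics Filter

variable {𝔸 α : Type*} [NormedRing 𝔸] [NormedAlgebra ℂ 𝔸]

/-- Termwise comparison of the tail with ‖X‖³ exp ‖X‖, using n! ≤ (n+3)!. Only positive powers of X
are estimated, so ‖1‖ = 1 is not needed; it fails for the Frobenius norm when N > 1. -/
theorem norm_exp_sub_quadratic_le [CompleteSpace 𝔸] (X : 𝔸) :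
    ‖NormedSpace.exp X - (1 + X + (2 : ℂ)⁻¹ • X ^ 2)‖ ≤ ‖X‖ ^ 3 * Real.exp ‖X‖ := by
  have hs := NormedSpace.exp_series_hasSum_exp' (𝕂 := ℂ) X
  have h1 := (hasSum_nat_add_iff' 3).2 hs
  simp only [Finset.sum_range_succ, Finset.sum_range_zero] at h1
  have h2 : HasSum (fun n : ℕ => ‖X‖ ^ 3 * ((n.factorial : ℝ)⁻¹ * ‖X‖ ^ n))
      (‖X‖ ^ 3 * Real.exp ‖X‖) := by
    have := (NormedSpace.exp_series_hasSum_exp' (𝕂 := ℝ) ‖X‖).mul_left (‖X‖ ^ 3)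
    rw [← Real.exp_eq_exp_ℝ] at this
    simpa using this
  have h3 : ∀ n : ℕ, ‖(((n + 3).factorial : ℂ)⁻¹) • X ^ (n + 3)‖ ≤
      ‖X‖ ^ 3 * ((n.factorial : ℝ)⁻¹ * ‖X‖ ^ n) := fun n => by
    rw [norm_smul, norm_inv, Complex.norm_natCast]
    have hf : (n.factorial : ℝ) ≤ ((n + 3).factorial : ℝ) :=
      Nat.cast_le.2 (Nat.factorial_le (by omega))
    have hn : (0 : ℝ) < n.factorial := Nat.cast_pos.2 n.factorial_pos
    calc ((n + 3).factorial : ℝ)⁻¹ * ‖X ^ (n + 3)‖ ≤ (n.factorial : ℝ)⁻¹ * ‖X‖ ^ (n + 3) := by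
          gcongr
          exact norm_pow_le' X (by omega)
      _ = _ := by rw [pow_add]; ring
  have h4 := tsum_of_norm_bounded h2 h3
  rw [h1.tsum_eq] at h4
  have e : 0 + ((Nat.factorial 0 : ℂ)⁻¹) • X ^ 0 + ((Nat.factorial 1 : ℂ)⁻¹) • X ^ 1 +
      ((Nat.factorial 2 : ℂ)⁻¹) • X ^ 2 = 1 + X + (2 : ℂ)⁻¹ • X ^ 2 := by
    simp [Nat.factorial]
  rwa [e] at h4

variable {l : Filter α} {a : α → ℝ}

theorem isBigO_exp_sub_quadratic [CompleteSpace 𝔸] {X : α → 𝔸} (ha : a =O[l] fun _ => (1 : ℝ))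
    (hX : X =O[l] a) :
    (fun p => NormedSpace.exp (X p) - (1 + X p + (2 : ℂ)⁻¹ • X p ^ 2)) =O[l] fun p => a p ^ 3 := by
  obtain ⟨c, hc⟩ := (hX.trans ha).bound
  have h : (fun p => NormedSpace.exp (X p) - (1 + X p + (2 : ℂ)⁻¹ • X p ^ 2)) =O[l]
      fun p => ‖X p‖ ^ 3 := by
    refine IsBigO.of_bound (Real.exp c) ?_
    filter_upwards [hc] with p hp
    rw [norm_one, mul_one] at hp
    refine (norm_exp_sub_quadratic_le (X p)).trans ?_
    rw [Real.norm_of_nonneg (by positivity), mul_comm]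
    gcongr
  exact h.trans (hX.norm_left.pow 3)

theorem isBigO_pow_of_le (ha : a =O[l] fun _ => (1 : ℝ)) {k n : ℕ} (hkn : k ≤ n) :
    (fun p => a p ^ n) =O[l] fun p => a p ^ k := by
  obtain ⟨r, rfl⟩ := Nat.exists_eq_add_of_le hkn
  simpa [pow_add] using (isBigO_refl (fun p => a p ^ k) l).mul (ha.pow r)

theorem isBigO_ofReal_pow_smul {X : α → 𝔸} (hX : X =O[l] fun _ => (1 : ℝ)) (k : ℕ) :
    (fun p => ((a p : ℂ) ^ k) • X p) =O[l] fun p => a p ^ k := by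
  have h : (fun p => (a p : ℂ) ^ k) =O[l] fun p => a p ^ k :=
    IsBigO.of_bound 1 (Eventually.of_forall fun p => by simp)
  simpa using h.smul hX

theorem isBigO_one_const {E : Type*} [NormedAddCommGroup E] (c : E) : (fun _ : α => c) =O[l] fun _ => (1 : ℝ) :=
  isBigO_const_const c one_ne_zero l

/-- Products of second-order expansions. -/
theorem isBigO_mul_sub_quadratic {X Y P P' Q Q' : α → 𝔸} (ha : a =O[l] fun _ => (1 : ℝ))
    (hP : P =O[l] fun _ => (1 : ℝ)) (hP' : P' =O[l] fun _ => (1 : ℝ))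
    (hQ : Q =O[l] fun _ => (1 : ℝ)) (hQ' : Q' =O[l] fun _ => (1 : ℝ))
    (hX : (fun p => X p - (1 + (a p : ℂ) • P p + ((a p : ℂ) ^ 2) • Q p)) =O[l] fun p => a p ^ 3)
    (hY : (fun p => Y p - (1 + (a p : ℂ) • P' p + ((a p : ℂ) ^ 2) • Q' p)) =O[l]
      fun p => a p ^ 3) :
    (fun p => X p * Y p - (1 + (a p : ℂ) • (P p + P' p) +
      ((a p : ℂ) ^ 2) • (Q p + Q' p + P p * P' p))) =O[l] fun p => a p ^ 3 := by
  have ha3 : (fun p => a p ^ 3) =O[l] fun _ => (1 : ℝ) := by simpa using ha.pow 3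
  have low : ∀ {P Q : α → 𝔸}, P =O[l] (fun _ => (1 : ℝ)) → Q =O[l] (fun _ => (1 : ℝ)) →
      (fun p => 1 + (a p : ℂ) • P p + ((a p : ℂ) ^ 2) • Q p) =O[l] fun _ => (1 : ℝ) := by
    intro P Q hP hQ
    have h1 := isBigO_ofReal_pow_smul (a := a) hP 1
    simp only [pow_one] at h1
    refine ((isBigO_one_const 1).add (h1.trans ha)).add
      ((isBigO_ofReal_pow_smul (a := a) hQ 2).trans ?_)
    simpa using ha.pow 2
  have hY1 : Y =O[l] fun _ => (1 : ℝ) := by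
    have := (hY.trans ha3).add (low hP' hQ')
    simpa using this
  -- With X₂, Y₂ the quadratic truncations, XY = (X - X₂)Y + X₂(Y - Y₂) + X₂Y₂. The terms of X₂Y₂ of
  -- order three and four are `e₃` and `e₄`.
  have e₁ := hX.mul hY1
  have e₂ := (low hP hQ).mul hY
  have e₃ : (fun p => ((a p : ℂ) ^ 3) • (P p * Q' p + Q p * P' p)) =O[l] fun p => a p ^ 3 :=
    isBigO_ofReal_pow_smul (by simpa using (hP.mul hQ').add (hQ.mul hP')) 3
  have e₄ : (fun p => ((a p : ℂ) ^ 4) • (Q p * Q' p)) =O[l] fun p => a p ^ 3 :=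
    (isBigO_ofReal_pow_smul (by simpa using hQ.mul hQ') 4).trans (isBigO_pow_of_le ha (by omega))
  simp only [mul_one, one_mul] at e₁ e₂
  refine (((e₁.add e₂).add e₃).add e₄).congr_left fun p => ?_
  simp only [mul_add, add_mul, sub_mul, mul_sub, one_mul, mul_one, smul_mul_assoc, mul_smul_comm,
    smul_smul, smul_add]
  ring_nf
  module

end Expansion

/-! ### Entries, trace and the Frobenius norm. -/

section MatrixNorm

open scoped Matrix.Norms.Frobenius

variable {N : ℕ}

theorem Matrix.frobenius_norm_sq (M : Matrix (Fin N) (Fin N) ℂ) :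
    ‖M‖ ^ 2 = ∑ p, ∑ q, ‖M p q‖ ^ 2 := by
  rw [Matrix.frobenius_norm_def, ← Real.sqrt_eq_rpow, Real.sq_sqrt]
  · simp
  · positivity

theorem Matrix.frobenius_norm_le_sum (M : Matrix (Fin N) (Fin N) ℂ) :
    ‖M‖ ≤ ∑ p, ∑ q, ‖M p q‖ := by
  refine le_of_sq_le_sq ?_ (by positivity)
  rw [Matrix.frobenius_norm_sq]
  refine (Finset.sum_le_sum fun p _ => ?_).trans
    (Finset.sum_sq_le_sq_sum_of_nonneg fun p _ => Finset.sum_nonneg fun q _ => norm_nonneg (M p q))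
  exact Finset.sum_sq_le_sq_sum_of_nonneg fun q _ => norm_nonneg (M p q)

theorem Matrix.norm_trace_le (M : Matrix (Fin N) (Fin N) ℂ) : ‖M.trace‖ ≤ N * ‖M‖ := by
  have h : ∀ p, ‖M p p‖ ≤ ‖M‖ := fun p => by
    refine le_of_sq_le_sq ?_ (norm_nonneg _)
    rw [Matrix.frobenius_norm_sq]
    refine (Finset.single_le_sum (f := fun q => ‖M p q‖ ^ 2) (fun q _ => by positivity)
      (Finset.mem_univ p)).trans ?_
    exact Finset.single_le_sum (f := fun p => ∑ q, ‖M p q‖ ^ 2) (fun q _ => by positivity)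
      (Finset.mem_univ p)
  refine (norm_sum_le_of_le _ fun p _ => h p).trans ?_
  simp

end MatrixNorm

/-! ## Smooth periodic matrix fields -/

/-- Matrix fields on the torus with smooth entries. -/
def IsSmoothField {d N : ℕ} (ℓ : ℝ) (M : MatrixField d N) : Prop :=
  ∀ p q, IsSmoothPeriodic ℓ fun x => M x p q

theorem IsTorusField.isSmoothField {d N : ℕ} {ℓ : ℝ} {M : MatrixField d N}
    (hM : IsTorusField ℓ M) : IsSmoothField ℓ M := fun p q =>
  ⟨hM.smooth p q, fun j x => by simp only [hM.periodic x j]⟩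

namespace IsSmoothField

variable {d N : ℕ} {ℓ : ℝ} {M M' : MatrixField d N}

theorem add (hM : IsSmoothField ℓ M) (hM' : IsSmoothField ℓ M') :
    IsSmoothField ℓ fun x => M x + M' x := fun p q => (hM p q).add (hM' p q)

theorem sub (hM : IsSmoothField ℓ M) (hM' : IsSmoothField ℓ M') :
    IsSmoothField ℓ fun x => M x - M' x := fun p q => (hM p q).sub (hM' p q)

theorem mul (hM : IsSmoothField ℓ M) (hM' : IsSmoothField ℓ M') :
    IsSmoothField ℓ fun x => M x * M' x := fun p q => by
  simp only [Matrix.mul_apply]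
  exact IsSmoothPeriodic.sum fun r => (hM p r).mul (hM' r q)

theorem smul (c : ℂ) (hM : IsSmoothField ℓ M) : IsSmoothField ℓ fun x => c • M x := fun p q =>
  (IsSmoothPeriodic.const c).mul (hM p q)

theorem sum {ι : Type*} {s : Finset ι} {M : ι → MatrixField d N}
    (hM : ∀ i, IsSmoothField ℓ (M i)) : IsSmoothField ℓ fun x => ∑ i ∈ s, M i x := fun p q => by
  simp only [Matrix.sum_apply]
  exact IsSmoothPeriodic.sum fun i => hM i p q

theorem pow (hM : IsSmoothField ℓ M) (k : ℕ) : IsSmoothField ℓ fun x => M x ^ k := by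
  induction k with
  | zero => exact fun p q => by simpa using IsSmoothPeriodic.const _
  | succ k ih => simpa only [pow_succ] using ih.mul hM

theorem partialDeriv (hM : IsSmoothField ℓ M) (j : Fin d) :
    IsSmoothField ℓ (MatrixField.partialDeriv j M) := fun p q => (hM p q).scalarPartial j

theorem covDeriv {A : Fin d → MatrixField d N} (hA : ∀ j, IsSmoothField ℓ (A j))
    (hM : IsSmoothField ℓ M) (j : Fin d) : IsSmoothField ℓ (MatrixField.covDeriv A j M) :=
  (hM.partialDeriv j).add ((((hA j).mul hM).sub (hM.mul (hA j))).smul Complex.I)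

theorem curvature {A : Fin d → MatrixField d N} (hA : ∀ j, IsSmoothField ℓ (A j)) (i j : Fin d) :
    IsSmoothField ℓ (MatrixField.curvature A i j) :=
  (((hA j).partialDeriv i).sub ((hA i).partialDeriv j)).add
    ((((hA i).mul (hA j)).sub ((hA j).mul (hA i))).smul Complex.I)

theorem trace (hM : IsSmoothField ℓ M) : IsSmoothPeriodic ℓ fun x => (M x).trace :=
  IsSmoothPeriodic.sum fun p => hM p p

end IsSmoothField

theorem MatrixField.partialDeriv_isHermitian {d N : ℕ} {ℓ : ℝ} {M : MatrixField d N}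
    (hM : IsTorusField ℓ M) (j : Fin d) (x : Fin d → ℝ) :
    (MatrixField.partialDeriv j M x).IsHermitian := by
  refine Matrix.IsHermitian.ext fun p q => ?_
  have h1 : (fun y => M y p q) = fun y => (starRingEnd ℂ) (M y q p) :=
    funext fun y => ((hM.hermitian y).apply p q).symm
  have h2 := ((hM.smooth q p).differentiable (by simp) x).hasFDerivAt
  have h3 := (Complex.conjCLE.toContinuousLinearMap.hasFDerivAt.comp x h2).fderiv
  simp only [MatrixField.partialDeriv, Matrix.of_apply]
  rw [h1]
  exact (DFunLike.congr_fun h3 (Pi.single j 1)).symm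

theorem Matrix.IsHermitian.I_smul_commutator {n : Type*} [Fintype n] {X Y : Matrix n n ℂ}
    (hX : X.IsHermitian) (hY : Y.IsHermitian) : (Complex.I • (X * Y - Y * X)).IsHermitian := by
  unfold Matrix.IsHermitian
  rw [Matrix.conjTranspose_smul, Matrix.conjTranspose_sub, Matrix.conjTranspose_mul,
    Matrix.conjTranspose_mul, hX.eq, hY.eq]
  simp only [Complex.star_def, Complex.conj_I]
  rw [neg_smul, ← smul_neg, neg_sub]

theorem MatrixField.covDeriv_isHermitian {d N : ℕ} {ℓ : ℝ} {A : Fin d → MatrixField d N}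
    {M : MatrixField d N} (hA : ∀ j, IsTorusField ℓ (A j)) (hM : IsTorusField ℓ M) (j : Fin d)
    (x : Fin d → ℝ) : (MatrixField.covDeriv A j M x).IsHermitian :=
  (MatrixField.partialDeriv_isHermitian hM j x).add
    (((hA j).hermitian x).I_smul_commutator (hM.hermitian x))

theorem MatrixField.curvature_isHermitian {d N : ℕ} {ℓ : ℝ} {A : Fin d → MatrixField d N}
    (hA : ∀ j, IsTorusField ℓ (A j)) (i j : Fin d)
    (x : Fin d → ℝ) : (MatrixField.curvature A i j x).IsHermitian :=
  ((MatrixField.partialDeriv_isHermitian (hA j) i x).sub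
    (MatrixField.partialDeriv_isHermitian (hA i) j x)).add
    (((hA i).hermitian x).I_smul_commutator ((hA j).hermitian x))

/-! ## Local expansions of the lattice fields -/

/-- The link matrix `exp (i a A_j(x))`. -/
noncomputable def linkField {d N : ℕ} (A : Fin d → MatrixField d N) (j : Fin d) (a : ℝ) :
    MatrixField d N :=
  fun x => NormedSpace.exp ((Complex.I * a) • A j x)

/-- The lattice field strength at `x`. -/
noncomputable def plaquetteDefect {d N : ℕ} (A : Fin d → MatrixField d N) (i j : Fin d) (a : ℝ) :
    MatrixField d N :=
  fun x => linkField A i a x * linkField A j a (x + Pi.single i a) -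
    linkField A j a x * linkField A i a (x + Pi.single j a)

/-- The lattice covariant derivative at `x`. -/
noncomputable def higgsDefect {d N : ℕ} (A : Fin d → MatrixField d N) (h : MatrixField d N)
    (j : Fin d) (a : ℝ) : MatrixField d N :=
  fun x => linkField A j a x * h (x + Pi.single j a) - h x * linkField A j a x

section LocalExpansion

open Asymptotics Filter
open scoped Matrix.Norms.Frobenius

variable {d N : ℕ} {ℓ : ℝ}

/-- The pairs `(a, x)` with `0 < a ≤ ℓ`. -/
def spacingFilter (d : ℕ) (ℓ : ℝ) : Filter (ℝ × (Fin d → ℝ)) :=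
  𝓟 {p | 0 < p.1 ∧ p.1 ≤ ℓ}

/-- On this principal filter a big-O is one bound for all a in (0, ℓ] and all x at once, with no
limit taken. This makes the constants below uniform in the vertex and in m. -/
theorem spacing_isBigO_one : (fun p => p.1) =O[spacingFilter d ℓ] fun _ => (1 : ℝ) := by
  refine isBigO_principal.2 ⟨ℓ, fun p hp => ?_⟩
  rw [Real.norm_of_nonneg hp.1.le, norm_one, mul_one]
  exact hp.2

namespace IsSmoothField

variable {M : MatrixField d N}

theorem isBigO_one (hℓ : 0 < ℓ) (hM : IsSmoothField ℓ M) {α : Type*} {l : Filter α}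
    (x : α → Fin d → ℝ) : (fun p => M (x p)) =O[l] fun _ => (1 : ℝ) := by
  choose K hK0 hK using fun p q => (hM p q).exists_norm_le hℓ
  refine IsBigO.of_bound (∑ p, ∑ q, K p q) (Eventually.of_forall fun y => ?_)
  rw [norm_one, mul_one]
  exact (Matrix.frobenius_norm_le_sum _).trans
    (Finset.sum_le_sum fun p _ => Finset.sum_le_sum fun q _ => hK p q _)

theorem isBigO_taylor (hℓ : 0 < ℓ) (hM : IsSmoothField ℓ M) (j : Fin d) :
    (fun p => M (p.2 + Pi.single j p.1) - M p.2 - (p.1 : ℂ) • MatrixField.partialDeriv j M p.2)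
      =O[spacingFilter d ℓ] fun p => p.1 ^ 2 := by
  choose K hK0 hK using fun p q => (hM p q).exists_taylor_le hℓ j
  refine isBigO_principal.2 ⟨∑ p, ∑ q, K p q, fun y hy => ?_⟩
  rw [Real.norm_of_nonneg (by positivity), Finset.sum_mul]
  simp only [Finset.sum_mul]
  exact (Matrix.frobenius_norm_le_sum _).trans
    (Finset.sum_le_sum fun p _ => Finset.sum_le_sum fun q _ => hK p q y.2 y.1 hy.1.le)

theorem isBigO_shift_sub (hℓ : 0 < ℓ) (hM : IsSmoothField ℓ M) (j : Fin d) :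
    (fun p => M (p.2 + Pi.single j p.1) - M p.2) =O[spacingFilter d ℓ] fun p => p.1 := by
  have h1 := (hM.isBigO_taylor hℓ j).trans
    (isBigO_pow_of_le spacing_isBigO_one (show 1 ≤ 2 by omega))
  have h2 := isBigO_ofReal_pow_smul (a := fun p : ℝ × (Fin d → ℝ) => p.1)
    ((hM.partialDeriv j).isBigO_one hℓ (l := spacingFilter d ℓ) fun p => p.2) 1
  simp only [pow_one] at h1 h2
  simpa using h1.add h2

end IsSmoothField

variable {A : Fin d → MatrixField d N} {h : MatrixField d N}

/-- The base point is an arbitrary function of the parameter, so that the expansion can also be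
applied at x + a𝐞_i. -/
theorem linkField_isBigO_quadratic (hℓ : 0 < ℓ) {α : Type*} {l : Filter α} {a : α → ℝ}
    (ha : a =O[l] fun _ => (1 : ℝ)) (hA : ∀ j, IsSmoothField ℓ (A j))
    (j : Fin d) (x : α → Fin d → ℝ) :
    (fun p => linkField A j (a p) (x p) - (1 + (a p : ℂ) • (Complex.I • A j (x p)) +
      ((a p : ℂ) ^ 2) • ((-2 : ℂ)⁻¹ • A j (x p) ^ 2))) =O[l] fun p => a p ^ 3 := by
  have h1 := isBigO_ofReal_pow_smul (a := a)
    (((hA j).smul Complex.I).isBigO_one hℓ (l := l) x) 1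
  simp only [pow_one, smul_smul] at h1
  simp only [mul_comm _ Complex.I] at h1
  refine (isBigO_exp_sub_quadratic ha h1).congr_left fun p => ?_
  simp only [linkField]
  congr 2
  · rw [smul_smul, mul_comm]
  · rw [smul_pow, smul_smul, smul_smul, mul_pow, Complex.I_sq]
    congr 1
    norm_num
    ring

/-- The expansion at the shifted point has its coefficients moved back to x. The first-order
coefficient needs a first-order Taylor formula, which produces ∂_i A_j; for the second-order one an
O(a) bound on the difference is enough. -/
theorem linkField_shift_isBigO_quadratic (hℓ : 0 < ℓ) (hA : ∀ j, IsSmoothField ℓ (A j))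
    (i j : Fin d) :
    (fun p => linkField A j p.1 (p.2 + Pi.single i p.1) - (1 + (p.1 : ℂ) • (Complex.I • A j p.2) +
      ((p.1 : ℂ) ^ 2) • (Complex.I • MatrixField.partialDeriv i (A j) p.2 +
        (-2 : ℂ)⁻¹ • A j p.2 ^ 2))) =O[spacingFilter d ℓ] fun p => p.1 ^ 3 := by
  have h0 := linkField_isBigO_quadratic hℓ (spacing_isBigO_one (d := d) (ℓ := ℓ)) hA j
    fun p => p.2 + Pi.single i p.1
  have scale : ∀ k : ℕ, (fun p => (p.1 : ℂ) ^ k) =O[spacingFilter d ℓ] fun p => p.1 ^ k := fun k =>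
    IsBigO.of_bound 1 (Eventually.of_forall fun p => by simp)
  have h1 := ((scale 1).smul ((hA j).isBigO_taylor hℓ i)).const_smul_left Complex.I
  have h3 := ((hA j).isBigO_one hℓ (l := spacingFilter d ℓ) fun p => p.2).mul
    ((hA j).isBigO_shift_sub hℓ i)
  simp only [mul_comm (1 : ℝ)] at h3
  have h2 := (scale 2).smul ((((hA j).isBigO_shift_sub hℓ i).mul
    ((hA j).isBigO_one hℓ (l := spacingFilter d ℓ) fun p => p.2 + Pi.single i p.1)).add
      h3)
  have h2' := h2.const_smul_left (-2 : ℂ)⁻¹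
  simp only [smul_eq_mul, mul_one] at h1 h2'
  have e1 : ∀ r : ℝ, r ^ 1 * r ^ 2 = r ^ 3 := fun r => by ring
  have e2 : ∀ r : ℝ, r ^ 2 * r = r ^ 3 := fun r => by ring
  simp only [e1] at h1
  simp only [e2] at h2'
  refine ((h0.add h1).add h2').congr_left fun p => ?_
  simp only [Pi.smul_apply, sq (A j _), sub_mul, mul_sub]
  module

/-- The two ways across the plaquette agree to first order and in the terms A_i², A_j². At order a²
there remains i(∂_i A_j - ∂_j A_i) - [A_i, A_j] = i F_ij. -/
theorem plaquetteDefect_isBigO (hℓ : 0 < ℓ) (hA : ∀ j, IsSmoothField ℓ (A j)) (i j : Fin d) :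
    (fun p => plaquetteDefect A i j p.1 p.2 -
      ((p.1 : ℂ) ^ 2) • (Complex.I • MatrixField.curvature A i j p.2))
      =O[spacingFilter d ℓ] fun p => p.1 ^ 3 := by
  have hb : ∀ {M : MatrixField d N}, IsSmoothField ℓ M →
      (fun p : ℝ × (Fin d → ℝ) => M p.2) =O[spacingFilter d ℓ] fun _ => (1 : ℝ) :=
    fun hM => hM.isBigO_one hℓ fun p : ℝ × (Fin d → ℝ) => p.2
  have key := fun i j : Fin d => isBigO_mul_sub_quadratic
    (X := fun p => linkField A i p.1 p.2)
    (Y := fun p => linkField A j p.1 (p.2 + Pi.single i p.1))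
    (spacing_isBigO_one (d := d) (ℓ := ℓ))
    (hb ((hA i).smul Complex.I)) (hb ((hA j).smul Complex.I))
    (hb (((hA i).pow 2).smul (-2 : ℂ)⁻¹))
    (hb ((((hA j).partialDeriv i).smul Complex.I).add (((hA j).pow 2).smul (-2 : ℂ)⁻¹)))
    (linkField_isBigO_quadratic hℓ spacing_isBigO_one hA i fun p => p.2)
    (linkField_shift_isBigO_quadratic hℓ hA i j)
  refine ((key i j).sub (key j i)).congr_left fun p => ?_
  simp only [plaquetteDefect, MatrixField.curvature, smul_mul_assoc, mul_smul_comm, smul_smul,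
    Complex.I_mul_I, smul_add]
  module

/-- The zeroth-order terms cancel, so first-order expansions of the link and of h suffice. The
exponent 1 and the scalar 1 are written out to match `isBigO_trace_mul_conjTranspose`. -/
theorem higgsDefect_isBigO (hℓ : 0 < ℓ) (hA : ∀ j, IsSmoothField ℓ (A j))
    (hh : IsSmoothField ℓ h) (j : Fin d) :
    (fun p => higgsDefect A h j p.1 p.2 - ((p.1 : ℂ) ^ 1) • ((1 : ℂ) • MatrixField.covDeriv A j h p.2))
      =O[spacingFilter d ℓ] fun p => p.1 ^ 2 := by
  have ha := spacing_isBigO_one (d := d) (ℓ := ℓ)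
  have hb : ∀ {M : MatrixField d N}, IsSmoothField ℓ M →
      (fun p : ℝ × (Fin d → ℝ) => M p.2) =O[spacingFilter d ℓ] fun _ => (1 : ℝ) :=
    fun hM => hM.isBigO_one hℓ fun p : ℝ × (Fin d → ℝ) => p.2
  have hb' := hh.isBigO_one hℓ (l := spacingFilter d ℓ) fun p => p.2 + Pi.single j p.1
  have hU : (fun p => linkField A j p.1 p.2 - (1 + (p.1 : ℂ) • (Complex.I • A j p.2)))
      =O[spacingFilter d ℓ] fun p => p.1 ^ 2 := by
    have h1 := (linkField_isBigO_quadratic hℓ ha hA j fun p => p.2).trans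
      (isBigO_pow_of_le ha (show 2 ≤ 3 by omega))
    have h2 := isBigO_ofReal_pow_smul (a := fun p : ℝ × (Fin d → ℝ) => p.1)
      (hb (((hA j).pow 2).smul (-2 : ℂ)⁻¹)) 2
    refine (h1.add h2).congr_left fun p => ?_
    abel
  have e1 := hU.mul hb'
  have e2 := (hb hh).mul hU
  have e3 := hh.isBigO_taylor hℓ j
  have e4 := isBigO_ofReal_pow_smul (a := fun p : ℝ × (Fin d → ℝ) => p.1)
    (hb ((hA j).smul Complex.I)) 1
  have e5 := e4.mul (hh.isBigO_shift_sub hℓ j)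
  have e6 : ∀ r : ℝ, r ^ 1 * r = r ^ 2 := fun r => by ring
  simp only [mul_one, one_mul, e6] at e1 e2 e5
  refine (((e1.sub e2).add e3).add e5).congr_left fun p => ?_
  simp only [higgsDefect, MatrixField.covDeriv, add_mul, sub_mul, mul_sub, mul_add, one_mul,
    mul_one, smul_mul_assoc, mul_smul_comm, pow_one]
  module

/-- With M the leading term, KK* - MM* = (K - M)K* + M(K - M)*, and K and M are both O(a^k); one
extra order in K - M is thus one extra order in the square. The phase c (i for plaquettes, 1 for the
Higgs field) cancels, and hermiticity turns FF* into F². -/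
theorem isBigO_trace_mul_conjTranspose {K : ℝ × (Fin d → ℝ) → Matrix (Fin N) (Fin N) ℂ}
    {F : MatrixField d N} {c : ℂ} {k : ℕ} (hc : c * star c = 1) (hℓ : 0 < ℓ)
    (hF : IsSmoothField ℓ F) (hFH : ∀ x, (F x).IsHermitian)
    (hK : (fun p => K p - ((p.1 : ℂ) ^ k) • (c • F p.2)) =O[spacingFilter d ℓ]
      fun p => p.1 ^ (k + 1)) :
    ∃ C, ∀ (a : ℝ) (x : Fin d → ℝ), 0 < a → a ≤ ℓ →
      ‖(K (a, x) * (K (a, x)).conjTranspose).trace - (a : ℂ) ^ (2 * k) * (F x ^ 2).trace‖ ≤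
        C * a ^ (2 * k + 1) := by
  have ha := spacing_isBigO_one (d := d) (ℓ := ℓ)
  have conj : ∀ {X : ℝ × (Fin d → ℝ) → Matrix (Fin N) (Fin N) ℂ} {r : ℕ},
      (X =O[spacingFilter d ℓ] fun p => p.1 ^ r) →
      (fun p => (X p).conjTranspose) =O[spacingFilter d ℓ] fun p => p.1 ^ r := fun {X r} hX => by
    refine IsBigO.trans (IsBigO.of_bound 1 (Eventually.of_forall fun p => ?_)) hX
    rw [Matrix.frobenius_norm_conjTranspose, one_mul]
  have hK0 := isBigO_ofReal_pow_smul (a := fun p : ℝ × (Fin d → ℝ) => p.1)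
    ((hF.smul c).isBigO_one hℓ (l := spacingFilter d ℓ) fun p => p.2) k
  have hKk : K =O[spacingFilter d ℓ] fun p => p.1 ^ k := by
    simpa using (hK.trans (isBigO_pow_of_le ha (Nat.le_succ k))).add hK0
  have e1 := hK.mul (conj hKk)
  have e2 := hK0.mul (conj hK)
  have p1 : ∀ r : ℝ, r ^ (k + 1) * r ^ k = r ^ (2 * k + 1) := fun r => by ring
  have p2 : ∀ r : ℝ, r ^ k * r ^ (k + 1) = r ^ (2 * k + 1) := fun r => by ring
  simp only [p1] at e1
  simp only [p2] at e2
  obtain ⟨C, hC⟩ := isBigO_principal.1 (e1.add e2)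
  refine ⟨N * C, fun a x ha0 haℓ => ?_⟩
  have := hC (a, x) ⟨ha0, haℓ⟩
  rw [Real.norm_of_nonneg (by positivity)] at this
  have heq : (K (a, x) * (K (a, x)).conjTranspose).trace - (a : ℂ) ^ (2 * k) * (F x ^ 2).trace =
      ((K (a, x) - ((a : ℂ) ^ k) • (c • F x)) * (K (a, x)).conjTranspose +
        (((a : ℂ) ^ k) • (c • F x)) *
          (K (a, x) - ((a : ℂ) ^ k) • (c • F x)).conjTranspose).trace := by
    have h2 : (((a : ℂ) ^ k) • (c • F x)) * (((a : ℂ) ^ k) • (c • F x)).conjTranspose =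
        ((a : ℂ) ^ (2 * k)) • F x ^ 2 := by
      rw [Matrix.conjTranspose_smul, Matrix.conjTranspose_smul, (hFH x).eq]
      simp only [smul_mul_assoc, mul_smul_comm, smul_smul, star_pow, Complex.star_def,
        Complex.conj_ofReal, sq (F x)]
      congr 1
      rw [← Complex.star_def]
      linear_combination (a : ℂ) ^ (2 * k) * hc
    rw [Matrix.conjTranspose_sub, mul_sub, sub_mul, h2, ← smul_eq_mul ((a : ℂ) ^ (2 * k)),
      ← Matrix.trace_smul, ← Matrix.trace_sub]
    congr 1
    abel
  rw [heq]
  refine (Matrix.norm_trace_le _).trans ?_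
  rw [mul_assoc]
  exact mul_le_mul_of_nonneg_left this (Nat.cast_nonneg N)

end LocalExpansion

theorem exists_trace_plaquetteDefect_le {d N : ℕ} {ℓ : ℝ} {A : Fin d → MatrixField d N}
    (hℓ : 0 < ℓ) (hA : ∀ j, IsTorusField ℓ (A j)) (i j : Fin d) :
    ∃ C, ∀ (a : ℝ) (x : Fin d → ℝ), 0 < a → a ≤ ℓ →
      ‖(plaquetteDefect A i j a x * (plaquetteDefect A i j a x).conjTranspose).trace -
        (a : ℂ) ^ 4 * (MatrixField.curvature A i j x ^ 2).trace‖ ≤ C * a ^ 5 :=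
  isBigO_trace_mul_conjTranspose (K := fun p => plaquetteDefect A i j p.1 p.2) (k := 2)
    (c := Complex.I) (by simp) hℓ
    (IsSmoothField.curvature (fun j => (hA j).isSmoothField) i j)
    (MatrixField.curvature_isHermitian hA i j)
    (plaquetteDefect_isBigO hℓ (fun j => (hA j).isSmoothField) i j)

theorem exists_trace_higgsDefect_le {d N : ℕ} {ℓ : ℝ} {A : Fin d → MatrixField d N}
    {h : MatrixField d N} (hℓ : 0 < ℓ) (hA : ∀ j, IsTorusField ℓ (A j)) (hh : IsTorusField ℓ h)
    (j : Fin d) :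
    ∃ C, ∀ (a : ℝ) (x : Fin d → ℝ), 0 < a → a ≤ ℓ →
      ‖(higgsDefect A h j a x * (higgsDefect A h j a x).conjTranspose).trace -
        (a : ℂ) ^ 2 * (MatrixField.covDeriv A j h x ^ 2).trace‖ ≤ C * a ^ 3 :=
  isBigO_trace_mul_conjTranspose (K := fun p => higgsDefect A h j p.1 p.2) (k := 1)
    (c := 1) (by simp) hℓ
    (IsSmoothField.covDeriv (fun j => (hA j).isSmoothField) hh.isSmoothField j)
    (MatrixField.covDeriv_isHermitian hA hh j)
    (higgsDefect_isBigO hℓ (fun j => (hA j).isSmoothField) hh.isSmoothField j)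

/-! ## Traces of powers of lattice hopping operators -/

section TracialExpansion

variable {B : Type*} [Ring B] [Algebra ℂ B] {τ : B →ₗ[ℂ] ℂ}

theorem tracial_add_sq (hτ : ∀ x y, τ (x * y) = τ (y * x)) (T y : B) :
    τ ((T + y) ^ 2) = τ (T * T) + 2 * τ (T * y) + τ (y ^ 2) := by
  simp only [pow_succ, pow_zero, one_mul, mul_add, add_mul, map_add]
  linear_combination -hτ T y

theorem tracial_add_cube (hτ : ∀ x y, τ (x * y) = τ (y * x)) (T y : B) :
    τ ((T + y) ^ 3) = τ (T * T * T) + 3 * τ (T * T * y) + 3 * τ (T * y ^ 2) + τ (y ^ 3) := by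
  have cyc : ∀ a b c, τ (a * b * c) = τ (c * a * b) := fun a b c => by
    rw [hτ, mul_assoc]
  simp only [pow_succ, pow_zero, one_mul, mul_add, add_mul, map_add, ← mul_assoc]
  linear_combination -2 * cyc T T y - cyc y T T - 2 * cyc T y y - cyc y T y

/-- Words are collected by cyclic class. The six words with two letters T split into four rotations
of TTyy and two of TyTy. -/
theorem tracial_add_fourth (hτ : ∀ x y, τ (x * y) = τ (y * x)) (T y : B) :
    τ ((T + y) ^ 4) = τ (T * T * T * T) + 4 * τ (T * T * T * y) + 4 * τ (T * T * y ^ 2) +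
      2 * τ (T * y * T * y) + 4 * τ (T * y ^ 3) + τ (y ^ 4) := by
  have cyc : ∀ a b c d, τ (a * b * c * d) = τ (d * a * b * c) := fun a b c d => by
    rw [hτ, mul_assoc, mul_assoc, mul_assoc]
  simp only [pow_succ, pow_zero, one_mul, mul_add, add_mul, map_add, ← mul_assoc]
  linear_combination -3 * cyc T T T y - 2 * cyc y T T T - cyc T y T T - 3 * cyc T T y y
    - 2 * cyc y T T y - cyc y y T T - cyc T y T y - 3 * cyc T y y y - 2 * cyc y T y y
    - cyc y y T y

end TracialExpansion

/-- The reversed signed direction. -/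
def oppositeDir {d : ℕ} (σ : Fin d × Bool) : Fin d × Bool := (σ.1, !σ.2)

@[simp] theorem oppositeDir_oppositeDir {d : ℕ} (σ : Fin d × Bool) :
    oppositeDir (oppositeDir σ) = σ := by simp [oppositeDir]

theorem oppositeDir_ne {d : ℕ} (σ : Fin d × Bool) : oppositeDir σ ≠ σ := fun h => by
  have := congrArg Prod.snd h
  simp [oppositeDir] at this

theorem oppositeDir_injective {d : ℕ} : Function.Injective (oppositeDir (d := d)) :=
  Function.LeftInverse.injective oppositeDir_oppositeDir

/-- Hopping operators `S σ` in the signed directions `σ` and an on-site operator `y`, with a trace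
which vanishes on the words that do not return to their starting point. -/
structure IsHoppingTrace {d : ℕ} {B : Type*} [Ring B] [Algebra ℂ B] (τ : B →ₗ[ℂ] ℂ)
    (S : Fin d × Bool → B) (y : B) : Prop where
  comm : ∀ x z, τ (x * z) = τ (z * x)
  inv : ∀ σ, S σ * S (oppositeDir σ) = 1
  one : ∀ σ k, τ (S σ * y ^ k) = 0
  two : ∀ σ₁ σ₂, σ₂ ≠ oppositeDir σ₁ → ∀ k l, τ (S σ₁ * y ^ k * S σ₂ * y ^ l) = 0
  three : ∀ σ₁ σ₂ σ₃ k, τ (S σ₁ * S σ₂ * S σ₃ * y ^ k) = 0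
  four : ∀ σ₁ σ₂ σ₃ σ₄, σ₂ ≠ oppositeDir σ₁ → σ₃ ≠ oppositeDir σ₂ →
    ¬ (σ₃ = oppositeDir σ₁ ∧ σ₄ = oppositeDir σ₂) → τ (S σ₁ * S σ₂ * S σ₃ * S σ₄) = 0

namespace IsHoppingTrace

variable {d : ℕ} {B : Type*} [Ring B] [Algebra ℂ B] {τ : B →ₗ[ℂ] ℂ} {S : Fin d × Bool → B} {y : B}

theorem sum_mul_pow (H : IsHoppingTrace τ S y) (k : ℕ) : τ ((∑ σ, S σ) * y ^ k) = 0 := by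
  simp [Finset.sum_mul, H.one]

theorem sum_mul_sum_mul (H : IsHoppingTrace τ S y) (k l : ℕ) :
    τ ((∑ σ, S σ) * y ^ k * (∑ σ, S σ) * y ^ l) =
      ∑ σ, τ (S σ * y ^ k * S (oppositeDir σ) * y ^ l) := by
  simp only [Finset.sum_mul, Finset.mul_sum, map_sum]
  rw [Finset.sum_comm]
  refine Finset.sum_congr rfl fun σ _ => ?_
  exact Finset.sum_eq_single _ (fun σ' _ h => H.two σ σ' h k l) (by simp)

theorem sum_sq_mul (H : IsHoppingTrace τ S y) (k : ℕ) :
    τ ((∑ σ, S σ) * (∑ σ, S σ) * y ^ k) = 2 * d * τ (y ^ k) := by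
  have := H.sum_mul_sum_mul 0 k
  simp only [pow_zero, mul_one, H.inv, one_mul] at this
  rw [this]
  simp only [Finset.sum_const, Finset.card_univ, Fintype.card_prod, Fintype.card_fin,
    Fintype.card_bool, nsmul_eq_mul]
  push_cast
  ring

theorem sum_cube_mul (H : IsHoppingTrace τ S y) (k : ℕ) :
    τ ((∑ σ, S σ) * (∑ σ, S σ) * (∑ σ, S σ) * y ^ k) = 0 := by
  simp [Finset.sum_mul, Finset.mul_sum, H.three]

theorem trace_pair (H : IsHoppingTrace τ S y) (σ₁ σ₂ : Fin d × Bool) :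
    τ (S σ₁ * S σ₂) = if σ₂ = oppositeDir σ₁ then τ 1 else 0 := by
  split_ifs with h
  · rw [h, H.inv]
  · simpa using H.two σ₁ σ₂ h 0 0

/-- Without initial backtracking a closed path undoes its first two steps either in reverse order or
in the same order (the plaquette); the two coincide when σ₂ = σ₁, hence the subtraction. If σ₂
undoes σ₁, any of the 2d backtracking pairs may follow; the first two terms already count two of
them, hence 2d - 2. -/
theorem sum_four_inner (H : IsHoppingTrace τ S y) (σ₁ σ₂ : Fin d × Bool) :
    ∑ σ₃, ∑ σ₄, τ (S σ₁ * S σ₂ * S σ₃ * S σ₄) =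
      τ 1 + τ (S σ₁ * S σ₂ * S (oppositeDir σ₁) * S (oppositeDir σ₂)) -
        (if σ₂ = σ₁ then τ 1 else 0) +
        (if σ₂ = oppositeDir σ₁ then (2 * d - 2) * τ 1 else 0) := by
  by_cases h : σ₂ = oppositeDir σ₁
  · subst h
    have h1 := H.inv σ₁
    have h2 := H.inv (oppositeDir σ₁)
    simp only [oppositeDir_oppositeDir] at h2
    simp only [h1, one_mul, H.trace_pair, oppositeDir_oppositeDir, h2, oppositeDir_ne, if_false,
      if_true, Finset.sum_ite_eq', Finset.mem_univ]
    simp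
    ring
  · have key : ∀ σ₃ σ₄, τ (S σ₁ * S σ₂ * S σ₃ * S σ₄) =
        (if σ₃ = oppositeDir σ₂ then (if σ₄ = oppositeDir σ₁ then τ 1 else 0) else 0) +
        (if σ₃ = oppositeDir σ₁ then (if σ₄ = oppositeDir σ₂ then
          (if σ₂ = σ₁ then 0 else
            τ (S σ₁ * S σ₂ * S (oppositeDir σ₁) * S (oppositeDir σ₂))) else 0) else 0) := by
      intro σ₃ σ₄
      by_cases h3 : σ₃ = oppositeDir σ₂
      · subst h3
        rw [mul_assoc (S σ₁), H.inv, mul_one, H.trace_pair]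
        by_cases h4 : σ₂ = σ₁
        · simp [h4]
        · simp [oppositeDir_injective.eq_iff, h4]
      · by_cases h5 : σ₃ = oppositeDir σ₁ ∧ σ₄ = oppositeDir σ₂
        · obtain ⟨rfl, rfl⟩ := h5
          have h6 : σ₂ ≠ σ₁ := fun e => h3 (by rw [e])
          simp [h3, h6]
        · rw [H.four σ₁ σ₂ σ₃ σ₄ h h3 h5]
          simp only [h3, if_false, zero_add]
          by_cases h7 : σ₃ = oppositeDir σ₁
          · simp [h7, show σ₄ ≠ oppositeDir σ₂ from fun e => h5 ⟨h7, e⟩]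
          · simp [h7]
    rw [Finset.sum_congr rfl fun σ₃ _ => Finset.sum_congr rfl fun σ₄ _ => key σ₃ σ₄]
    simp only [Finset.sum_add_distrib]
    have hsum : ∀ (α β : Fin d × Bool) (c : ℂ),
        ∑ σ₃, ∑ σ₄, (if σ₃ = α then (if σ₄ = β then c else 0) else 0) = c := by
      intro α β c
      rw [Finset.sum_eq_single α (fun σ _ hσ => by simp [hσ]) (by simp)]
      simp
    rw [hsum, hsum]
    by_cases h4 : σ₂ = σ₁
    · subst h4
      have h8 : S σ₂ * S σ₂ * S (oppositeDir σ₂) * S (oppositeDir σ₂) = 1 := by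
        rw [mul_assoc (S σ₂), H.inv, mul_one, H.inv]
      simp [h8, (oppositeDir_ne σ₂).symm]
    · simp [h4, h]

/-- The second factor stands for the adjoint of the commutator. Two products collapse to 1, and the
cross terms are the plaquette in its two orientations. -/
theorem commutator_mul (H : IsHoppingTrace τ S y) (i j : Fin d) :
    τ ((S (i, true) * S (j, true) - S (j, true) * S (i, true)) *
        (S (j, false) * S (i, false) - S (i, false) * S (j, false))) =
      2 * τ 1 - τ (S (i, true) * S (j, true) * S (i, false) * S (j, false)) -
        τ (S (j, true) * S (i, true) * S (j, false) * S (i, false)) := by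
  have hi : ∀ i, S (i, true) * S (i, false) = 1 := fun i => H.inv (i, true)
  have h1 : ∀ i j, S (i, true) * S (j, true) * (S (j, false) * S (i, false)) = 1 := fun i j => by
    rw [mul_assoc, ← mul_assoc (S (j, true)), hi, one_mul, hi]
  simp only [sub_mul, mul_sub, map_sub, h1]
  simp only [← mul_assoc]
  ring

/-- Summing `sum_four_inner` over 4d² pairs gives 4d² - 2d + 2d(2d - 2) = 8d² - 6d, plus the
plaquettes. Trading these for commutator squares adds 4d², for a total of 12d² - 6d, the number of
closed walks of length four in ℤ^d. -/
theorem sum_fourth (H : IsHoppingTrace τ S y) :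
    τ ((∑ σ, S σ) * (∑ σ, S σ) * (∑ σ, S σ) * (∑ σ, S σ)) = (12 * d ^ 2 - 6 * d) * τ 1 -
      2 * ∑ i, ∑ j, τ ((S (i, true) * S (j, true) - S (j, true) * S (i, true)) *
        (S (j, false) * S (i, false) - S (i, false) * S (j, false))) := by
  have cyc : ∀ a b c d, τ (a * b * c * d) = τ (d * a * b * c) := fun a b c d => by
    rw [H.comm, mul_assoc, mul_assoc, mul_assoc]
  have expand : τ ((∑ σ, S σ) * (∑ σ, S σ) * (∑ σ, S σ) * (∑ σ, S σ)) =
      ∑ σ₁, ∑ σ₂, ∑ σ₃, ∑ σ₄, τ (S σ₁ * S σ₂ * S σ₃ * S σ₄) := by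
    simp only [← map_sum]
    congr 1
    rw [Finset.sum_mul_sum, Finset.sum_mul, Finset.sum_mul]
    refine Finset.sum_congr rfl fun σ₁ _ => ?_
    rw [Finset.sum_mul, Finset.sum_mul]
    refine Finset.sum_congr rfl fun σ₂ _ => ?_
    rw [mul_assoc, Finset.sum_mul_sum, Finset.mul_sum]
    refine Finset.sum_congr rfl fun σ₃ _ => ?_
    simp only [Finset.mul_sum, mul_assoc]
  -- For fixed i and j the four sign choices are, up to rotation, each orientation twice.
  have plaq : ∑ σ₁, ∑ σ₂, τ (S σ₁ * S σ₂ * S (oppositeDir σ₁) * S (oppositeDir σ₂)) =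
      2 * ∑ i, ∑ j, (τ (S (i, true) * S (j, true) * S (i, false) * S (j, false)) +
        τ (S (j, true) * S (i, true) * S (j, false) * S (i, false))) := by
    simp only [Fintype.sum_prod_type, Fintype.sum_bool, oppositeDir, Bool.not_true, Bool.not_false]
    simp only [← Finset.sum_add_distrib, Finset.mul_sum]
    refine Finset.sum_congr rfl fun i _ => Finset.sum_congr rfl fun j _ => ?_
    linear_combination cyc (S (i, true)) (S (j, false)) (S (i, false)) (S (j, true)) -
      cyc (S (j, true)) (S (i, true)) (S (j, false)) (S (i, false)) -
      cyc (S (i, true)) (S (j, true)) (S (i, false)) (S (j, false)) -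
      cyc (S (j, false)) (S (i, true)) (S (j, true)) (S (i, false))
  rw [expand]
  simp only [H.sum_four_inner, Finset.sum_add_distrib, Finset.sum_sub_distrib, plaq,
    H.commutator_mul]
  simp
  ring

theorem sum_mul_self_mul_self (H : IsHoppingTrace τ S y) :
    2 * τ ((∑ σ, S σ) * y * (∑ σ, S σ) * y) = 4 * d * τ (y ^ 2) -
      2 * ∑ j, τ ((S (j, true) * y - y * S (j, true)) *
        (y * S (j, false) - S (j, false) * y)) := by
  have h0 := H.sum_mul_sum_mul 1 1
  simp only [pow_one] at h0
  have cyc : ∀ a b c d, τ (a * b * c * d) = τ (d * a * b * c) := fun a b c d => by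
    rw [H.comm, mul_assoc, mul_assoc, mul_assoc]
  have key : ∀ j, τ ((S (j, true) * y - y * S (j, true)) * (y * S (j, false) - S (j, false) * y)) =
      2 * τ (y ^ 2) - (τ (S (j, true) * y * S (j, false) * y) +
        τ (S (j, false) * y * S (j, true) * y)) := fun j => by
    have h1 : S (j, true) * S (j, false) = 1 := H.inv (j, true)
    have h2 : S (j, false) * S (j, true) = 1 := H.inv (j, false)
    have h3 : τ (S (j, true) * y * y * S (j, false)) = τ (y ^ 2) := by
      rw [cyc, h2, one_mul, sq]
    have h4 : τ (y * S (j, true) * S (j, false) * y) = τ (y ^ 2) := by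
      rw [mul_assoc y, h1, mul_one, sq]
    simp only [sub_mul, mul_sub, map_sub, ← mul_assoc]
    linear_combination h3 + h4 - cyc (y) (S (j, true)) y (S (j, false))
  rw [h0]
  simp only [key, Fintype.sum_prod_type, Fintype.sum_bool, oppositeDir, Bool.not_true,
    Bool.not_false, Finset.sum_sub_distrib]
  simp
  ring

theorem pow_two (H : IsHoppingTrace τ S y) :
    τ ((∑ σ, S σ + y) ^ 2) = 2 * d * τ 1 + τ (y ^ 2) := by
  have h1 := H.sum_sq_mul 0
  have h2 := H.sum_mul_pow 1
  simp only [pow_zero, mul_one, pow_one] at h1 h2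
  rw [tracial_add_sq H.comm, h1, h2]
  ring

theorem pow_three (H : IsHoppingTrace τ S y) :
    τ ((∑ σ, S σ + y) ^ 3) = 6 * d * τ y + τ (y ^ 3) := by
  have h1 := H.sum_cube_mul 0
  have h2 := H.sum_sq_mul 1
  simp only [pow_zero, mul_one, pow_one] at h1 h2
  rw [tracial_add_cube H.comm, h1, h2, H.sum_mul_pow]
  ring

/-- The coefficient 12d of y² is 8d from the four words TTyy plus 4d from the words TyTy, once the
latter are traded for commutator squares. -/
theorem pow_four (H : IsHoppingTrace τ S y) :
    τ ((∑ σ, S σ + y) ^ 4) = (12 * d ^ 2 - 6 * d) * τ 1 -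
      2 * ∑ i, ∑ j, τ ((S (i, true) * S (j, true) - S (j, true) * S (i, true)) *
        (S (j, false) * S (i, false) - S (i, false) * S (j, false))) +
      12 * d * τ (y ^ 2) -
      2 * ∑ j, τ ((S (j, true) * y - y * S (j, true)) *
        (y * S (j, false) - S (j, false) * y)) + τ (y ^ 4) := by
  have h1 := H.sum_cube_mul 1
  simp only [pow_one] at h1
  rw [tracial_add_fourth H.comm, h1, H.sum_mul_pow, H.sum_sq_mul, H.sum_fourth]
  linear_combination H.sum_mul_self_mul_self

end IsHoppingTrace

/-! ## Block shift matrices -/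

section BlockShift

variable {V R : Type*} [DecidableEq V] [AddCommGroup V] [Ring R]

/-- The block matrix with entries `K v` at the positions `(v, v + g)`. -/
def blockShift (g : V) (K : V → R) : Matrix V V R :=
  Matrix.of fun v w => if w = v + g then K v else 0

theorem blockShift_apply (g : V) (K : V → R) (v w : V) :
    blockShift g K v w = if w = v + g then K v else 0 := rfl

/-- Displacements add under multiplication, so by `blockTrace_blockShift` the vanishing of a word's
trace becomes a statement about its total displacement in V. -/
theorem blockShift_mul [Fintype V] (g g' : V) (K K' : V → R) :
    blockShift g K * blockShift g' K' = blockShift (g + g') fun v => K v * K' (v + g) := by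
  ext v w
  rw [Matrix.mul_apply, Finset.sum_eq_single (v + g)]
  · simp [blockShift_apply, add_assoc]
  · intro u _ hu
    simp [blockShift_apply, hu]
  · simp

theorem blockShift_sub (g : V) (K K' : V → R) :
    blockShift g K - blockShift g K' = blockShift g fun v => K v - K' v := by
  ext v w
  simp only [Matrix.sub_apply, blockShift_apply]
  split_ifs <;> simp

theorem blockShift_one : blockShift (0 : V) (fun _ => (1 : R)) = 1 := by
  ext v w
  simp [blockShift_apply, Matrix.one_apply, eq_comm]

theorem blockShift_zero_pow [Fintype V] (K : V → R) (k : ℕ) :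
    blockShift (0 : V) K ^ k = blockShift 0 fun v => K v ^ k := by
  induction k with
  | zero => simp only [pow_zero, blockShift_one]
  | succ k ih => simp [pow_succ, ih, blockShift_mul]

theorem star_blockShift [StarRing R] (g : V) (K : V → R) :
    star (blockShift g K) = blockShift (-g) fun v => star (K (v - g)) := by
  ext v w
  simp only [Matrix.star_apply, blockShift_apply]
  by_cases h : v = w + g
  · subst h; simp
  · have : w ≠ v + -g := fun e => h (by rw [e]; abel)
    simp [h, this]

end BlockShift

/-! ### The trace on block matrices. -/

section BlockTrace

variable {V n : Type*} [Fintype V] [Fintype n]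

/-- The trace of a block matrix. -/
noncomputable def blockTrace (V n : Type*) [Fintype V] [Fintype n] :
    Matrix V V (Matrix n n ℂ) →ₗ[ℂ] ℂ :=
  (Matrix.traceLinearMap n ℂ ℂ).comp (Matrix.traceLinearMap V ℂ (Matrix n n ℂ))

theorem blockTrace_apply (X : Matrix V V (Matrix n n ℂ)) :
    blockTrace V n X = ∑ v, (X v v).trace := by
  simp [blockTrace, Matrix.trace, Finset.sum_comm (γ := V)]

theorem blockTrace_mul_comm (X Y : Matrix V V (Matrix n n ℂ)) :
    blockTrace V n (X * Y) = blockTrace V n (Y * X) := by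
  simp only [blockTrace_apply, Matrix.mul_apply, Matrix.trace_sum]
  rw [Finset.sum_comm]
  exact Finset.sum_congr rfl fun v _ => Finset.sum_congr rfl fun w _ => Matrix.trace_mul_comm _ _

variable [DecidableEq V] [AddCommGroup V]

theorem blockTrace_blockShift [DecidableEq n] (g : V) (K : V → Matrix n n ℂ) :
    blockTrace V n (blockShift g K) = if g = 0 then ∑ v, (K v).trace else 0 := by
  rw [blockTrace_apply]
  split_ifs with h
  · subst h; simp [blockShift_apply]
  · simp [blockShift_apply, h]

theorem blockTrace_blockShift_mul_star [DecidableEq n] (g : V) (K : V → Matrix n n ℂ) :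
    blockTrace V n (blockShift g K * star (blockShift g K)) =
      ∑ v, (K v * (K v).conjTranspose).trace := by
  rw [star_blockShift, blockShift_mul, blockTrace_blockShift, if_pos (by abel)]
  simp [Matrix.star_eq_conjTranspose]

end BlockTrace

/-! ## Hopping on the torus lattice -/

section Hopping

variable {d m : ℕ}

/-- The integral coordinates of a signed direction. -/
def dirCoord (σ : Fin d × Bool) (k : Fin d) : ℤ :=
  if k = σ.1 then (if σ.2 then 1 else -1) else 0

/-- The displacement of a signed direction. -/
def dirVec (m : ℕ) (σ : Fin d × Bool) : Fin d → ZMod m := fun k => (dirCoord σ k : ZMod m)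

theorem dirVec_true (j : Fin d) : dirVec m (j, true) = Pi.single j 1 := by
  funext k
  by_cases hk : k = j <;> simp [dirVec, dirCoord, hk]

theorem dirVec_opposite (σ : Fin d × Bool) : dirVec m (oppositeDir σ) = -dirVec m σ := by
  funext k
  rcases σ with ⟨j, b⟩
  by_cases hk : k = j <;> cases b <;> simp [dirVec, dirCoord, oppositeDir, hk]

theorem abs_dirCoord_le (σ : Fin d × Bool) (k : Fin d) : |dirCoord σ k| ≤ 1 := by
  unfold dirCoord
  split_ifs <;> simp

theorem int_eq_zero_of_cast_zmod {z : ℤ} (hz : |z| < m) (h : (z : ZMod m) = 0) : z = 0 :=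
  Int.eq_zero_of_abs_lt_dvd ((ZMod.intCast_zmod_eq_zero_iff_dvd z m).1 h) hz

/-- Four numbers in {-1, 0, 1} have a sum of absolute value at most 4 < m, so no walk of four steps
winds around the torus. This is the source of the bound m ≥ 5. -/
theorem dirCoord_sum_four {σ₁ σ₂ σ₃ σ₄ : Fin d × Bool} (hm : 5 ≤ m)
    (h : dirVec m σ₁ + dirVec m σ₂ + dirVec m σ₃ + dirVec m σ₄ = 0) (k : Fin d) :
    dirCoord σ₁ k + dirCoord σ₂ k + dirCoord σ₃ k + dirCoord σ₄ k = 0 := by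
  have h1 := abs_le.1 (abs_dirCoord_le σ₁ k)
  have h2 := abs_le.1 (abs_dirCoord_le σ₂ k)
  have h3 := abs_le.1 (abs_dirCoord_le σ₃ k)
  have h4 := abs_le.1 (abs_dirCoord_le σ₄ k)
  refine int_eq_zero_of_cast_zmod (m := m) (abs_lt.2 ⟨by omega, by omega⟩) ?_
  simpa [dirVec] using congrFun h k

theorem dirVec_ne_zero (hm : 5 ≤ m) (σ : Fin d × Bool) : dirVec m σ ≠ 0 := fun h => by
  -- A vanishing displacement repeated four times still vanishes, so the four-step lemma covers
  -- shorter words as well.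
  have h1 := dirCoord_sum_four (σ₁ := σ) (σ₂ := σ) (σ₃ := σ) (σ₄ := σ) hm (by simp [h]) σ.1
  simp only [dirCoord, if_true] at h1
  split_ifs at h1 <;> omega

theorem eq_opposite_of_dirVec_add (hm : 5 ≤ m) {σ₁ σ₂ : Fin d × Bool}
    (h : dirVec m σ₁ + dirVec m σ₂ = 0) : σ₂ = oppositeDir σ₁ := by
  have h1 := dirCoord_sum_four (σ₁ := σ₁) (σ₂ := σ₂) (σ₃ := σ₁) (σ₄ := σ₂) hm
    (by rw [add_assoc, h, add_zero]) σ₁.1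
  rcases σ₁ with ⟨i, b⟩
  rcases σ₂ with ⟨j, c⟩
  by_cases hij : i = j
  · subst hij
    cases b <;> cases c <;> simp_all [dirCoord, oppositeDir]
  · cases b <;> cases c <;> simp_all [dirCoord]

/-- Parity: lifted to ℤ, the sum of all coordinates is a sum of three signs, hence odd. -/
theorem dirVec_sum_three_ne_zero (hm : 5 ≤ m) (σ₁ σ₂ σ₃ : Fin d × Bool) :
    dirVec m σ₁ + dirVec m σ₂ + dirVec m σ₃ ≠ 0 := fun h => by
  have hs : ∀ σ : Fin d × Bool, ∑ k, dirCoord σ k = if σ.2 then 1 else -1 := fun σ => by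
    simp [dirCoord]
  have hz : (dirCoord σ₁ + dirCoord σ₂ + dirCoord σ₃ : Fin d → ℤ) = 0 := by
    funext k
    have h1 := abs_le.1 (abs_dirCoord_le σ₁ k)
    have h2 := abs_le.1 (abs_dirCoord_le σ₂ k)
    have h3 := abs_le.1 (abs_dirCoord_le σ₃ k)
    refine int_eq_zero_of_cast_zmod (m := m) (abs_lt.2 ?_) ?_
    · simp only [Pi.add_apply]
      exact ⟨by omega, by omega⟩
    · simpa [dirVec] using congrFun h k
  have h4 : ∑ k, (dirCoord σ₁ k + dirCoord σ₂ k + dirCoord σ₃ k) = 0 :=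
    Finset.sum_eq_zero fun k _ => congrFun hz k
  rw [Finset.sum_add_distrib, Finset.sum_add_distrib, hs, hs, hs] at h4
  split_ifs at h4 <;> omega

/-- Along the axis of σ₁ some later step must undo σ₁. It is not σ₂, and if it were σ₄ then σ₃ would
undo σ₂; so it is σ₃, and the other two steps cancel. -/
theorem opposite_of_dirVec_sum_four (hm : 5 ≤ m) {σ₁ σ₂ σ₃ σ₄ : Fin d × Bool}
    (h₁₂ : σ₂ ≠ oppositeDir σ₁) (h₂₃ : σ₃ ≠ oppositeDir σ₂)
    (h : dirVec m σ₁ + dirVec m σ₂ + dirVec m σ₃ + dirVec m σ₄ = 0) :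
    σ₃ = oppositeDir σ₁ ∧ σ₄ = oppositeDir σ₂ := by
  have hc := dirCoord_sum_four hm h σ₁.1
  have h3 : σ₃ = oppositeDir σ₁ := by
    by_contra h3
    have h4 : σ₄ = oppositeDir σ₁ := by
      rcases σ₁ with ⟨i₁, b₁⟩
      rcases σ₂ with ⟨i₂, b₂⟩
      rcases σ₃ with ⟨i₃, b₃⟩
      rcases σ₄ with ⟨i₄, b₄⟩
      simp only [dirCoord, oppositeDir, ne_eq, Prod.mk.injEq] at *
      cases b₁ <;> cases b₂ <;> cases b₃ <;> cases b₄ <;> grind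
    refine h₂₃ (eq_opposite_of_dirVec_add hm ?_)
    rw [h4, dirVec_opposite] at h
    rw [← h]; abel
  refine ⟨h3, eq_opposite_of_dirVec_add hm ?_⟩
  rw [h3, dirVec_opposite] at h
  rw [← h]; abel

variable {n : Type*} [Fintype n] [DecidableEq n]

/-- The entries of the hopping operators with link matrices `U`. -/
def hopEntry (U : Fin d → (Fin d → ZMod m) → Matrix n n ℂ) (σ : Fin d × Bool)
    (v : Fin d → ZMod m) : Matrix n n ℂ :=
  if σ.2 then U σ.1 v else star (U σ.1 (v - Pi.single σ.1 1))

/-- The hopping operators with link matrices `U`. -/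
def hop (U : Fin d → (Fin d → ZMod m) → Matrix n n ℂ) (σ : Fin d × Bool) :
    Matrix (Fin d → ZMod m) (Fin d → ZMod m) (Matrix n n ℂ) :=
  blockShift (dirVec m σ) (hopEntry U σ)

theorem hop_true (U : Fin d → (Fin d → ZMod m) → Matrix n n ℂ) (j : Fin d) :
    hop U (j, true) = blockShift (Pi.single j 1) (U j) := by
  simp only [hop, dirVec_true]; rfl

theorem hop_false (U : Fin d → (Fin d → ZMod m) → Matrix n n ℂ) (j : Fin d) :
    hop U (j, false) = star (hop U (j, true)) := by
  rw [hop_true, star_blockShift, hop, show (j, false) = oppositeDir (j, true) from rfl,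
    dirVec_opposite, dirVec_true]
  rfl

variable [NeZero m]

/-- Unitarity of the links is needed only for `inv`; the vanishing conditions follow from
displacements alone. -/
theorem isHoppingTrace (hm : 5 ≤ m) {U : Fin d → (Fin d → ZMod m) → Matrix n n ℂ}
    (hU : ∀ j v, U j v ∈ unitary (Matrix n n ℂ)) (y : (Fin d → ZMod m) → Matrix n n ℂ) :
    IsHoppingTrace (blockTrace (Fin d → ZMod m) n) (hop U) (blockShift 0 y) where
  comm := blockTrace_mul_comm
  inv := by
    rintro ⟨j, b⟩
    cases b
    · rw [show oppositeDir (j, false) = (j, true) from rfl, hop_false, hop_true, star_blockShift,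
        blockShift_mul, ← blockShift_one, neg_add_cancel]
      congr 1
      funext v
      rw [← sub_eq_add_neg]
      exact Unitary.star_mul_self_of_mem (hU _ _)
    · rw [show oppositeDir (j, true) = (j, false) from rfl, hop_false, hop_true, star_blockShift,
        blockShift_mul, ← blockShift_one, add_neg_cancel]
      congr 1
      funext v
      rw [add_sub_cancel_right]
      exact Unitary.mul_star_self_of_mem (hU _ _)
  one σ k := by
    rw [blockShift_zero_pow, hop, blockShift_mul, blockTrace_blockShift, if_neg]
    simpa using dirVec_ne_zero hm σ
  two σ₁ σ₂ h k l := by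
    rw [blockShift_zero_pow, blockShift_zero_pow, hop, hop, blockShift_mul, blockShift_mul,
      blockShift_mul, blockTrace_blockShift, if_neg]
    simpa using fun e => h (eq_opposite_of_dirVec_add hm e)
  three σ₁ σ₂ σ₃ k := by
    rw [blockShift_zero_pow, hop, hop, hop, blockShift_mul, blockShift_mul,
      blockShift_mul, blockTrace_blockShift, if_neg]
    simpa using dirVec_sum_three_ne_zero hm σ₁ σ₂ σ₃
  four σ₁ σ₂ σ₃ σ₄ h₁ h₂ h₃ := by
    rw [hop, hop, hop, hop, blockShift_mul, blockShift_mul,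
      blockShift_mul, blockTrace_blockShift, if_neg]
    exact fun e => h₃ (opposite_of_dirVec_sum_four hm h₁ h₂ e)

theorem blockTrace_hop_commutator (U : Fin d → (Fin d → ZMod m) → Matrix n n ℂ) (i j : Fin d) :
    blockTrace (Fin d → ZMod m) n
      ((hop U (i, true) * hop U (j, true) - hop U (j, true) * hop U (i, true)) *
        (hop U (j, false) * hop U (i, false) - hop U (i, false) * hop U (j, false))) =
      ∑ v, ((U i v * U j (v + Pi.single i 1) - U j v * U i (v + Pi.single j 1)) *
        (U i v * U j (v + Pi.single i 1) - U j v * U i (v + Pi.single j 1)).conjTranspose).trace := by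
  have e : hop U (j, false) * hop U (i, false) - hop U (i, false) * hop U (j, false) =
      star (hop U (i, true) * hop U (j, true) - hop U (j, true) * hop U (i, true)) := by
    rw [hop_false, hop_false, star_sub, star_mul, star_mul]
  rw [e, hop_true, hop_true, blockShift_mul, blockShift_mul,
    add_comm (Pi.single j (1 : ZMod m) : Fin d → ZMod m), blockShift_sub,
    blockTrace_blockShift_mul_star]

theorem blockTrace_hop_commutator_diagonal (U : Fin d → (Fin d → ZMod m) → Matrix n n ℂ)
    {y : (Fin d → ZMod m) → Matrix n n ℂ} (hy : ∀ v, (y v).IsHermitian) (j : Fin d) :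
    blockTrace (Fin d → ZMod m) n
      ((hop U (j, true) * blockShift 0 y - blockShift 0 y * hop U (j, true)) *
        (blockShift 0 y * hop U (j, false) - hop U (j, false) * blockShift 0 y)) =
      ∑ v, ((U j v * y (v + Pi.single j 1) - y v * U j v) *
        (U j v * y (v + Pi.single j 1) - y v * U j v).conjTranspose).trace := by
  have hs : star (blockShift 0 y) = blockShift 0 y := by
    rw [star_blockShift, neg_zero]
    congr 1
    funext v
    rw [sub_zero]
    exact (hy v).eq
  have e : blockShift 0 y * hop U (j, false) - hop U (j, false) * blockShift 0 y =
      star (hop U (j, true) * blockShift 0 y - blockShift 0 y * hop U (j, true)) := by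
    rw [hop_false, star_sub, star_mul, star_mul, hs]
  rw [e, hop_true, blockShift_mul, blockShift_mul, zero_add, add_zero, blockShift_sub,
    blockTrace_blockShift_mul_star]
  simp only [add_zero]

end Hopping

/-! ## The Dirac operator as a block matrix -/

/-- Conjugation by the frames and flattening of block matrices are algebra isomorphisms onto the
endomorphisms of V × Fin N → ℂ. They commute with p, so only D and X themselves have to be compared.
-/
theorem trace_aeval_eq_blockTrace {V : Type*} [Fintype V] [DecidableEq V] {N : ℕ} {H : V → Type*}
    [∀ v, AddCommGroup (H v)] [∀ v, Module ℂ (H v)]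
    (u : ∀ v, H v ≃ₗ[ℂ] EuclideanSpace ℂ (Fin N)) (D : Module.End ℂ (∀ v, H v))
    (X : Matrix V V (Matrix (Fin N) (Fin N) ℂ))
    (hX : ∀ ψ v, u v (D ψ v) = ∑ w, Matrix.toEuclideanLin (X v w) (u w (ψ w)))
    (p : Polynomial ℂ) :
    LinearMap.trace ℂ _ (Polynomial.aeval D p) =
      blockTrace V (Fin N) (Polynomial.aeval X p) := by
  set e : (∀ v, H v) ≃ₗ[ℂ] (V × Fin N → ℂ) :=
    (LinearEquiv.piCongrRight fun v => (u v).trans (WithLp.linearEquiv 2 ℂ (Fin N → ℂ))).trans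
      (LinearEquiv.curry ℂ ℂ V (Fin N)).symm with he
  have heapp : ∀ ψ v q, e ψ (v, q) = (u v (ψ v)) q := fun ψ v q => rfl
  set Ψ := (Matrix.compAlgEquiv V (Fin N) ℂ ℂ).trans Matrix.toLinAlgEquiv' with hΨ
  have hconj : e.conjAlgEquiv ℂ D = Ψ X := by
    refine LinearMap.ext fun φ => ?_
    obtain ⟨ψ, rfl⟩ := e.surjective φ
    have h1 : e.conjAlgEquiv ℂ D (e ψ) = e (D ψ) := by
      simp [LinearEquiv.conjAlgEquiv_apply]
    rw [h1]
    funext ⟨v, q⟩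
    rw [heapp, hX]
    have h2 : Ψ X (e ψ) (v, q) = ∑ w, ∑ r, X v w q r * (u w (ψ w)) r := by
      simp only [hΨ, AlgEquiv.trans_apply, Matrix.toLinAlgEquiv'_apply, Matrix.mulVec, dotProduct,
        Fintype.sum_prod_type]
      rfl
    rw [h2]
    simp [Matrix.toLpLin_apply, Matrix.mulVec, dotProduct]
  have htr : ∀ Y, LinearMap.trace ℂ _ (Ψ Y) = blockTrace V (Fin N) Y := fun Y => by
    have h3 : Ψ Y = Matrix.toLin' (Matrix.comp V V (Fin N) (Fin N) ℂ Y) := rfl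
    rw [h3, Matrix.trace_toLin'_eq, blockTrace_apply]
    simp [Matrix.trace, Fintype.sum_prod_type]
  rw [← LinearMap.trace_conj' _ e, ← htr, ← Polynomial.aeval_algHom_apply Ψ, ← hconj,
    Polynomial.aeval_algHom_apply]
  rfl

theorem LinearIsometryEquiv.linearMap_adjoint_eq_symm {E F : Type*} [NormedAddCommGroup E]
    [NormedAddCommGroup F] [InnerProductSpace ℂ E] [InnerProductSpace ℂ F] [FiniteDimensional ℂ E]
    [FiniteDimensional ℂ F] (L : E ≃ₗᵢ[ℂ] F) :
    LinearMap.adjoint L.toLinearEquiv.toLinearMap = L.symm.toLinearEquiv.toLinearMap := by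
  refine ((LinearMap.eq_adjoint_iff _ _).2 fun x y => ?_).symm
  have := L.symm.inner_map_eq_flip x y
  simpa using this

theorem WithLoops.sum_hom {V : Type} [DecidableEq V] [Quiver.{0} V]
    [∀ v w : V, Fintype (v ⟶ w)] {M : Type*} [AddCommMonoid M] (v w : WithLoops V)
    (g : (v ⟶ w) → M) :
    ∑ e, g e = ∑ e : v.base ⟶ w.base, g (Sum.inl e) +
      ∑ e : PLift (v = w), g (Sum.inr e) :=
  Fintype.sum_sum_type g

theorem TorusLattice.sum_hom {d m : ℕ} {M : Type*} [AddCommMonoid M] (v w : TorusLattice d m)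
    (g : Fin d → M) :
    ∑ e : v ⟶ w, g e.1 = ∑ j, if v.shift j = w then g j else 0 := by
  rw [← Finset.sum_filter]
  exact (Finset.sum_subtype (p := fun j => v.shift j = w) (Finset.univ.filter fun j => v.shift j = w)
    (fun j => by simp) g).symm

/-- The coordinates of a vertex. -/
def TorusLattice.coord {d m : ℕ} (v : TorusLattice d m) : Fin d → ZMod m := v

theorem TorusLattice.shift_eq_iff {d m : ℕ} (v w : TorusLattice d m) (j : Fin d) :
    v.shift j = w ↔ w.coord = v.coord + Pi.single j 1 := by
  have : (v.shift j).coord = v.coord + Pi.single j 1 := by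
    funext k
    rw [Pi.add_apply, Pi.single_apply]
    rfl
  rw [← this]
  exact eq_comm

/-- The point at which a vertex sits, in terms of its coordinates. -/
def latticePoint {d m : ℕ} (a : ℝ) (v : Fin d → ZMod m) : Fin d → ℝ := fun k => a * ((v k).val : ℝ)

theorem linkField_mem_unitary {d N : ℕ} {ℓ : ℝ} {A : Fin d → MatrixField d N}
    (hA : ∀ j, IsTorusField ℓ (A j)) (j : Fin d) (a : ℝ) (x : Fin d → ℝ) :
    linkField A j a x ∈ unitary (Matrix (Fin N) (Fin N) ℂ) := by
  have hs : ((Complex.I * a) • A j x).conjTranspose = -((Complex.I * a) • A j x) := by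
    rw [Matrix.conjTranspose_smul, ((hA j).hermitian x).eq]
    simp
  have h1 : star (linkField A j a x) = NormedSpace.exp (-((Complex.I * a) • A j x)) := by
    rw [← hs, Matrix.exp_conjTranspose]; rfl
  have h2 := Matrix.exp_add_of_commute _ _ (Commute.neg_right (Commute.refl ((Complex.I * a) • A j x)))
  have h3 := Matrix.exp_add_of_commute _ _ (Commute.neg_left (Commute.refl ((Complex.I * a) • A j x)))
  rw [add_neg_cancel, NormedSpace.exp_zero] at h2
  rw [neg_add_cancel, NormedSpace.exp_zero] at h3
  rw [Unitary.mem_iff, h1]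
  exact ⟨h3.symm, h2.symm⟩

/-- The block matrix of `a D` for the fields sampled from `A` and `h`. -/
noncomputable def latticeDirac {d N : ℕ} (m : ℕ) (A : Fin d → MatrixField d N)
    (h : MatrixField d N) (a : ℝ) :
    Matrix (Fin d → ZMod m) (Fin d → ZMod m) (Matrix (Fin N) (Fin N) ℂ) :=
  ∑ σ, hop (fun j v => linkField A j a (latticePoint a v)) σ +
    blockShift 0 fun v => (a : ℂ) • h (latticePoint a v)

section Sample

variable {d m N : ℕ} {a ℓ : ℝ} {A : Fin d → MatrixField d N} {h : MatrixField d N}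
  {R : QuiverRep (LoopedTorus d m)} {ρ : EdgeLength (LoopedTorus d m)}
  {u : ∀ v, (R.obj v).H ≃ₗᵢ[ℂ] EuclideanSpace ℂ (Fin N)}

theorem IsLatticeSample.weight_adjoint (hS : IsLatticeSample a A h R ρ u) (ha : a ≠ 0)
    {v w : TorusLattice d m} (e : v ⟶ w) (x : (R.obj (.of w)).H) :
    (a : ℂ) • u (.of v) (LinearMap.adjoint (R.weight ρ (WithLoops.old e)) x) =
      Matrix.toEuclideanLin (linkField A e.1 a (v.point a)) (u (.of w) x) := by
  obtain ⟨j, rfl⟩ := e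
  have := hS.gauge v j (u (.of (v.shift j)) x)
  rw [LinearIsometryEquiv.symm_apply_apply] at this
  unfold linkField
  rw [← this]
  unfold QuiverRep.weight
  rw [hS.spacing, map_smulₛₗ, LinearIsometryEquiv.linearMap_adjoint_eq_symm]
  have ha' : (a : ℂ) ≠ 0 := Complex.ofReal_ne_zero.2 ha
  simp only [LinearMap.smul_apply, map_smul, smul_smul, map_inv₀, Complex.conj_ofReal,
    mul_inv_cancel₀ ha', one_smul]
  rfl

theorem IsLatticeSample.weight (hS : IsLatticeSample a A h R ρ u) (ha : a ≠ 0)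
    (hA : ∀ j, IsTorusField ℓ (A j))
    {v w : TorusLattice d m} (e : v ⟶ w) (x : (R.obj (.of v)).H) :
    (a : ℂ) • u (.of w) (R.weight ρ (WithLoops.old e) x) =
      Matrix.toEuclideanLin (star (linkField A e.1 a (v.point a))) (u (.of v) x) := by
  obtain ⟨j, rfl⟩ := e
  have h1 := hS.gauge v j (u (.of (v.shift j)) (R.link (WithLoops.old (v.edge j)) x))
  rw [LinearIsometryEquiv.symm_apply_apply, LinearIsometryEquiv.symm_apply_apply] at h1
  have hU := Unitary.star_mul_self_of_mem (linkField_mem_unitary hA j a (v.point a))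
  unfold QuiverRep.weight
  have ha' : (a : ℂ) ≠ 0 := Complex.ofReal_ne_zero.2 ha
  rw [hS.spacing, h1]
  simp only [LinearMap.smul_apply, map_smul, smul_smul, mul_inv_cancel₀ ha', one_smul]
  change u (.of (v.shift j)) (R.link (WithLoops.old (v.edge j)) x) =
    Matrix.toEuclideanLin (star (linkField A j a (v.point a)))
      (Matrix.toEuclideanLin (linkField A j a (v.point a)) _)
  rw [Matrix.toLpLin_apply, Matrix.toLpLin_apply]
  simp only [Matrix.mulVec_mulVec, hU, Matrix.one_mulVec]

theorem IsLatticeSample.sum_weight (hS : IsLatticeSample a A h R ρ u) (ha : a ≠ 0)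
    (hA : ∀ j, IsTorusField ℓ (A j)) (v w : TorusLattice d m) (x : (R.obj (.of v)).H) :
    (a : ℂ) • u (.of w) ((∑ e : v ⟶ w, R.weight ρ (WithLoops.old e)) x) =
      Matrix.toEuclideanLin (∑ j, if v.shift j = w then
          star (linkField A j a (v.point a)) else 0) (u (.of v) x) := by
  rw [← TorusLattice.sum_hom, LinearMap.sum_apply, map_sum, map_sum, LinearMap.sum_apply,
    Finset.smul_sum]
  exact Finset.sum_congr rfl fun e _ => hS.weight ha hA e x

theorem IsLatticeSample.sum_weight_adjoint (hS : IsLatticeSample a A h R ρ u) (ha : a ≠ 0)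
    (v w : TorusLattice d m) (x : (R.obj (.of w)).H) :
    (a : ℂ) • u (.of v) ((∑ e : v ⟶ w, LinearMap.adjoint (R.weight ρ (WithLoops.old e))) x) =
      Matrix.toEuclideanLin (∑ j, if v.shift j = w then
          linkField A j a (v.point a) else 0) (u (.of w) x) := by
  rw [← TorusLattice.sum_hom, LinearMap.sum_apply, map_sum, map_sum, LinearMap.sum_apply,
    Finset.smul_sum]
  exact Finset.sum_congr rfl fun e _ => hS.weight_adjoint ha e x

/-- Lattice edges into v match the hops in negative directions, those out of v the hops in positive
directions, and a loop together with its adjoint the diagonal term. Parallel edges are summed on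
both sides, so no lower bound on m is needed. -/
theorem IsLatticeSample.diracBlock [NeZero m] (hS : IsLatticeSample a A h R ρ u) (ha : a ≠ 0)
    (hA : ∀ j, IsTorusField ℓ (A j)) (v w : LoopedTorus d m) (x : (R.obj w).H) :
    (a : ℂ) • u v (R.diracBlock ρ v w x) =
      Matrix.toEuclideanLin (latticeDirac m A h a v.base.coord w.base.coord) (u w x) := by
  have hL : latticeDirac m A h a v.base.coord w.base.coord =
      ((∑ j, if TorusLattice.shift w.base j = v.base then
          star (linkField A j a (w.base.point a)) else 0) +
        ∑ j, if TorusLattice.shift v.base j = w.base then linkField A j a (v.base.point a) else 0) +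
        if v = w then (a : ℂ) • h (v.base.point a) else 0 := by
    unfold latticeDirac
    rw [Matrix.add_apply, Matrix.sum_apply, Fintype.sum_prod_type]
    simp only [Fintype.sum_bool, Finset.sum_add_distrib]
    rw [add_comm (∑ j, hop _ (j, true) _ _)]
    congr 1
    · congr 1
      · refine Finset.sum_congr rfl fun j _ => ?_
        rw [hop_false, Matrix.star_apply, hop_true, blockShift_apply, apply_ite star, star_zero]
        exact if_congr (TorusLattice.shift_eq_iff _ _ _).symm rfl rfl
      · refine Finset.sum_congr rfl fun j _ => ?_
        rw [hop_true, blockShift_apply]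
        exact if_congr (TorusLattice.shift_eq_iff _ _ _).symm rfl rfl
    · rw [blockShift_apply]
      have : w.base.coord = v.base.coord + 0 ↔ v = w := by
        rw [add_zero]; exact eq_comm
      exact if_congr this rfl rfl
  have h1 : (a : ℂ) • u v ((∑ e : w.base ⟶ v.base, R.weight ρ (Sum.inl e : w ⟶ v)) x) =
      Matrix.toEuclideanLin (∑ j, if TorusLattice.shift w.base j = v.base then
          star (linkField A j a (w.base.point a)) else 0) (u w x) :=
    hS.sum_weight ha hA w.base v.base x
  have h2 : (a : ℂ) • u v ((∑ e : v.base ⟶ w.base,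
        LinearMap.adjoint (R.weight ρ (Sum.inl e : v ⟶ w))) x) =
      Matrix.toEuclideanLin (∑ j, if TorusLattice.shift v.base j = w.base then
          linkField A j a (v.base.point a) else 0) (u w x) :=
    hS.sum_weight_adjoint ha v.base w.base x
  have h3 : (a : ℂ) • u v ((∑ e : PLift (w = v), R.weight ρ (Sum.inr e : w ⟶ v) +
        ∑ e : PLift (v = w), LinearMap.adjoint (R.weight ρ (Sum.inr e : v ⟶ w))) x) =
      Matrix.toEuclideanLin (if v = w then (a : ℂ) • h (v.base.point a) else 0) (u w x) := by
    by_cases hvw : v = w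
    · subst hvw
      have hu : ∀ {M : Type} [AddCommMonoid M] (g : PLift (v = v) → M),
          ∑ e : PLift (v = v), g e = g ⟨rfl⟩ := fun g =>
        Fintype.sum_subsingleton g ⟨rfl⟩
      rw [hu, hu, if_pos rfl, map_smul, LinearMap.smul_apply]
      have := hS.higgs v.base (u v x)
      rw [← this]
      congr 2
      change _ = R.higgs ρ v ((u v).symm (u v x))
      rw [LinearIsometryEquiv.symm_apply_apply]
      rfl
    · have : IsEmpty (PLift (v = w)) := ⟨fun e => hvw e.down⟩
      have : IsEmpty (PLift (w = v)) := ⟨fun e => hvw e.down.symm⟩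
      simp [hvw]
  rw [hL, map_add, map_add, LinearMap.add_apply, LinearMap.add_apply, ← h1, ← h2, ← h3]
  unfold QuiverRep.diracBlock
  rw [WithLoops.sum_hom, WithLoops.sum_hom]
  simp only [LinearMap.add_apply, map_add, smul_add]
  rw [add_add_add_comm]

theorem IsLatticeSample.spectralAction_eq [NeZero m] (hS : IsLatticeSample a A h R ρ u)
    (ha : a ≠ 0) (hA : ∀ j, IsTorusField ℓ (A j)) (f : Polynomial ℝ) :
    spectralAction f (R.dirac ρ) (1 / a) =
      blockTrace (Fin d → ZMod m) (Fin N)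
        (Polynomial.aeval (latticeDirac m A h a) (f.map (algebraMap ℝ ℂ))) := by
  unfold spectralAction
  refine trace_aeval_eq_blockTrace (V := LoopedTorus d m) (fun v => (u v).toLinearEquiv) _
    (latticeDirac m A h a) (fun ψ v => ?_) _
  have h1 : (((1 / a : ℝ) : ℂ)⁻¹ • R.dirac ρ) ψ v = (a : ℂ) • ∑ w, R.diracBlock ρ v w (ψ w) := by
    simp [QuiverRep.dirac]
  rw [h1, map_smul, map_sum, Finset.smul_sum]
  exact Finset.sum_congr rfl fun w _ => hS.diracBlock ha hA v w (ψ w)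

end Sample

/-! ## Representations are constant up to isomorphism -/

namespace PrespectralTriple

variable {X Y : PrespectralTriple}

theorem Hom.algMap_injective (S : Hom X Y) : Function.Injective S.algMap := fun a b hab => by
  refine X.faithful (LinearMap.ext fun ψ => S.trans.injective ?_)
  have ha := S.compat a (S.trans ψ)
  have hb := S.compat b (S.trans ψ)
  rw [LinearIsometryEquiv.symm_apply_apply] at ha hb
  rw [← ha, ← hb, hab]

/-- A morphism whose algebra map is bijective is an isomorphism. -/
noncomputable def Hom.toIso (S : Hom X Y) (hS : Function.Bijective S.algMap) : X ≅ Y where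
  hom := S
  inv :=
    { algMap := ((StarAlgEquiv.ofBijective S.algMap hS).symm : Y.A →⋆ₐ[ℂ] X.A)
      trans := S.trans.symm
      compat := fun b ψ => by
        obtain ⟨a, rfl⟩ := hS.2 b
        have h1 : (StarAlgEquiv.ofBijective S.algMap hS).symm (S.algMap a) = a :=
          (StarAlgEquiv.ofBijective S.algMap hS).symm_apply_apply a
        have h2 := S.compat a (S.trans ψ)
        rw [LinearIsometryEquiv.symm_apply_apply] at h2
        change X.act ((StarAlgEquiv.ofBijective S.algMap hS).symm (S.algMap a)) ψ =
          S.trans.symm (Y.act (S.algMap a) (S.trans ψ))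
        rw [h1, h2, LinearIsometryEquiv.symm_apply_apply] }
  hom_inv_id := Hom.ext
    (StarAlgHom.ext fun a => (StarAlgEquiv.ofBijective S.algMap hS).symm_apply_apply a)
    (LinearIsometryEquiv.ext fun ψ => S.trans.symm_apply_apply ψ)
  inv_hom_id := Hom.ext
    (StarAlgHom.ext fun b => (StarAlgEquiv.ofBijective S.algMap hS).apply_symm_apply b)
    (LinearIsometryEquiv.ext fun ψ => S.trans.apply_symm_apply ψ)

theorem Hom.finrank_hilbert (S : Hom X Y) : Module.finrank ℂ X.H = Module.finrank ℂ Y.H :=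
  S.trans.toLinearEquiv.finrank_eq

theorem Hom.finrank_algebra_le (S : Hom X Y) : Module.finrank ℂ X.A ≤ Module.finrank ℂ Y.A :=
  LinearMap.finrank_le_finrank_of_injective
    (f := (S.algMap : X.A →ₐ[ℂ] Y.A).toLinearMap) S.algMap_injective

theorem finrank_algebra_le_sq (X : PrespectralTriple) :
    Module.finrank ℂ X.A ≤ Module.finrank ℂ X.H * Module.finrank ℂ X.H := by
  rw [← Module.finrank_linearMap ℂ ℂ X.H X.H]
  exact LinearMap.finrank_le_finrank_of_injective
    (f := (X.act : X.A →ₐ[ℂ] Module.End ℂ X.H).toLinearMap) X.faithful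

/-- Faithfulness makes algebra maps of morphisms injective, so N² ≤ dim A_X ≤ dim A_Y ≤ (dim H_Y)² =
N²; equality forces bijectivity. -/
theorem nonempty_iso_matrixTriple {N : ℕ} (S : X ⟶ Y) (hX : Nonempty (X ≅ matrixTriple N)) :
    Nonempty (Y ≅ matrixTriple N) := by
  obtain ⟨i⟩ := hX
  have S' : Hom X Y := S
  have hH : Module.finrank ℂ Y.H = N := by
    rw [← Hom.finrank_hilbert S', Hom.finrank_hilbert (show Hom X (matrixTriple N) from i.hom)]
    exact finrank_euclideanSpace_fin
  have hA : N * N ≤ Module.finrank ℂ X.A := by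
    have := Hom.finrank_algebra_le (show Hom (matrixTriple N) X from i.inv)
    have e : Module.finrank ℂ (matrixTriple N).A = N * N := by
      change Module.finrank ℂ (Matrix (Fin N) (Fin N) ℂ) = N * N
      simp [Module.finrank_matrix]
    rwa [e] at this
  have hle := Y.finrank_algebra_le_sq
  rw [hH] at hle
  have heq : Module.finrank ℂ X.A = Module.finrank ℂ Y.A :=
    le_antisymm (Hom.finrank_algebra_le S') (hle.trans hA)
  have hsurj : Function.Surjective S'.algMap :=
    (LinearMap.injective_iff_surjective_of_finrank_eq_finrank heq
      (f := (S'.algMap : X.A →ₐ[ℂ] Y.A).toLinearMap)).1 S'.algMap_injective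
  exact ⟨(S'.toIso ⟨S'.algMap_injective, hsurj⟩).symm ≪≫ i⟩

end PrespectralTriple

/-- The translations preserving P form a submonoid. The vectors 𝐞_j have finite order, so positive
steps alone generate the whole group and no inverse edges are needed. -/
theorem TorusLattice.forall_of_shift {d m : ℕ} [NeZero m] {P : TorusLattice d m → Prop}
    (hP : ∀ v j, P v → P (v.shift j)) {v₀ : TorusLattice d m} (h₀ : P v₀) (v : TorusLattice d m) :
    P v := by
  set Q : (Fin d → ZMod m) → Prop := P
  let M : AddSubmonoid (Fin d → ZMod m) :=
    { carrier := {g | ∀ w, Q w → Q (w + g)}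
      zero_mem' := fun w hw => by simpa using hw
      add_mem' := fun {g g'} hg hg' w hw => by
        rw [← add_assoc]; exact hg' _ (hg _ hw) }
  have hs : ∀ j, Pi.single j 1 ∈ M := fun j w hw => by
    have h1 := hP w j hw
    have h2 := (TorusLattice.shift_eq_iff (show TorusLattice d m from w) _ j).1 rfl
    rw [TorusLattice.coord, TorusLattice.coord] at h2
    change P (w + Pi.single j 1 : Fin d → ZMod m)
    rw [← h2]
    exact h1
  have hall : ∀ g, g ∈ M := fun g => by
    rw [← Finset.univ_sum_single g]
    refine M.sum_mem fun j _ => ?_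
    have : Pi.single j (g j) = (g j).val • (Pi.single j 1 : Fin d → ZMod m) := by
      rw [← Pi.single_smul, nsmul_eq_mul, mul_one, ZMod.natCast_zmod_val]
    rw [this]
    exact M.nsmul_mem (hs j) _
  have := hall (v.coord - v₀.coord) v₀.coord h₀
  rwa [add_sub_cancel] at this

theorem QuiverRep.nonempty_iso_matrixTriple {d m N : ℕ} [NeZero m]
    (R : QuiverRep (LoopedTorus d m)) {v₀ : LoopedTorus d m}
    (h₀ : Nonempty (R.obj v₀ ≅ PrespectralTriple.matrixTriple N)) (v : LoopedTorus d m) :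
    Nonempty (R.obj v ≅ PrespectralTriple.matrixTriple N) :=
  TorusLattice.forall_of_shift
    (P := fun v => Nonempty (R.obj (WithLoops.of v) ≅ PrespectralTriple.matrixTriple N))
    (fun v j hv => PrespectralTriple.nonempty_iso_matrixTriple
      (R.map (WithLoops.old (v.edge j))) hv) (v₀ := v₀.base) h₀ v.base

/-! ## The smooth limit -/

section SmoothLimit

variable {d N : ℕ} {ℓ : ℝ}

/-- The two points coincide unless v_j = m - 1; there the coordinate wraps to 0 and they differ by
the period ℓ. -/
theorem latticePoint_add_single {m : ℕ} [NeZero m] {a : ℝ} (ham : a * m = ℓ) {M : MatrixField d N}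
    (hM : IsTorusField ℓ M) (v : Fin d → ZMod m) (j : Fin d) :
    M (latticePoint a (v + Pi.single j 1)) = M (latticePoint a v + Pi.single j a) := by
  by_cases hv : (v j).val + 1 < m
  · congr 1
    funext k
    by_cases hk : k = j
    · subst hk
      have : (v k + 1).val = (v k).val + 1 := by
        rw [show v k + 1 = (((v k).val + 1 : ℕ) : ZMod m) by simp, ZMod.val_natCast_of_lt hv]
      simp only [latticePoint, Pi.add_apply, Pi.single_eq_same, this]
      push_cast; ring
    · simp [latticePoint, hk]
  · have hval : (v j).val + 1 = m := by have := ZMod.val_lt (v j); omega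
    have h0 : v j + 1 = 0 := by
      have : (((v j).val + 1 : ℕ) : ZMod m) = 0 := by rw [hval]; simp
      simpa using this
    rw [← hM.periodic _ j]
    congr 1
    funext k
    by_cases hk : k = j
    · subst hk
      simp only [latticePoint, Pi.add_apply, Pi.single_eq_same, h0, ZMod.val_zero]
      have hr : (m : ℝ) = (v k).val + 1 := by exact_mod_cast hval.symm
      rw [← ham, Nat.cast_zero]
      linear_combination a * hr
    · simp [latticePoint, hk]

/-- One factor of a^k raises the Riemann error a⁴ to a⁵, and the others are bounded by ℓ^(k-1); this
is why k ≥ 1 is required. -/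
theorem exists_latticeSum_le (hℓ : 0 < ℓ) {M : MatrixField d N} (hM : IsSmoothField ℓ M) {k : ℕ}
    (hk : 1 ≤ k) :
    ∃ C, ∀ (m : ℕ) [NeZero m] (a : ℝ), 0 < a → a ≤ ℓ → a * m = ℓ →
      ‖(a : ℂ) ^ k * (∑ v : Fin d → ZMod m, (M (latticePoint a v)).trace -
        ((1 / a : ℝ) : ℂ) ^ d * MatrixField.integralTrace ℓ M)‖ ≤ C * (a ^ 5 * (1 / a) ^ d) := by
  obtain ⟨C, hC0, hC⟩ := hM.trace.exists_riemannSum_le hℓ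
  refine ⟨C * ℓ ^ (k - 1), fun m _ a ha haℓ ham => ?_⟩
  have h1 := hC m a ham
  have ha' : (a : ℂ) ≠ 0 := Complex.ofReal_ne_zero.2 ha.ne'
  have e : ∑ v : Fin d → ZMod m, (M (latticePoint a v)).trace -
      ((1 / a : ℝ) : ℂ) ^ d * MatrixField.integralTrace ℓ M =
      ((1 / a : ℝ) : ℂ) ^ d * (a ^ d • ∑ v : Fin d → ZMod m, (M fun k => a * (v k).val).trace -
        ∫ x in Set.Icc (0 : Fin d → ℝ) (fun _ => ℓ), (M x).trace) := by
    rw [mul_sub, Complex.real_smul, ← mul_assoc]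
    push_cast
    rw [← mul_pow, one_div, inv_mul_cancel₀ ha', one_pow, one_mul]
    rfl
  rw [e, norm_mul, norm_mul, norm_pow, norm_pow, Complex.norm_real, Complex.norm_real,
    Real.norm_of_nonneg ha.le, Real.norm_of_nonneg (by positivity)]
  obtain ⟨r, rfl⟩ := Nat.exists_eq_add_of_le' hk
  calc a ^ (r + 1) * ((1 / a) ^ d * _) ≤ ℓ ^ r * a * ((1 / a) ^ d * (C * a ^ 4)) := by
        rw [pow_succ]; gcongr
    _ = _ := by rw [Nat.add_sub_cancel]; ring

theorem norm_latticeSum_le {m : ℕ} [NeZero m] {a : ℝ} (ha : 0 < a) (ham : a * m = ℓ)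
    {G : (Fin d → ℝ) → ℂ} {C : ℝ} (hG : ∀ x, ‖G x‖ ≤ C * a ^ 5) :
    ‖∑ v : Fin d → ZMod m, G (latticePoint a v)‖ ≤ C * ℓ ^ d * (a ^ 5 * (1 / a) ^ d) := by
  refine (norm_sum_le_of_le _ fun v _ => hG _).trans (le_of_eq ?_)
  rw [Finset.sum_const, Finset.card_univ, Fintype.card_pi, Finset.prod_const, Finset.card_univ,
    Fintype.card_fin, ZMod.card, nsmul_eq_mul, ← ham]
  have : (a * m) ^ d * (1 / a) ^ d = (m : ℝ) ^ d := by
    rw [← mul_pow]; congr 1; field_simp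
  push_cast
  rw [← this]; ring

theorem exists_plaquetteSum_le (hℓ : 0 < ℓ) {A : Fin d → MatrixField d N}
    (hA : ∀ j, IsTorusField ℓ (A j)) :
    ∃ C, ∀ (m : ℕ) [NeZero m] (a : ℝ), 0 < a → a ≤ ℓ → a * m = ℓ →
      ‖(∑ i, ∑ j, ∑ v : Fin d → ZMod m, (plaquetteDefect A i j a (latticePoint a v) *
          (plaquetteDefect A i j a (latticePoint a v)).conjTranspose).trace) -
        (a : ℂ) ^ 4 * ∑ v : Fin d → ZMod m,
          (∑ i, ∑ j, MatrixField.curvature A i j (latticePoint a v) ^ 2).trace‖ ≤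
        C * (a ^ 5 * (1 / a) ^ d) := by
  choose C hC using fun i j => exists_trace_plaquetteDefect_le hℓ hA i j
  refine ⟨∑ i, ∑ j, C i j * ℓ ^ d, fun m _ a ha haℓ ham => ?_⟩
  have e : (∑ i, ∑ j, ∑ v : Fin d → ZMod m, (plaquetteDefect A i j a (latticePoint a v) *
          (plaquetteDefect A i j a (latticePoint a v)).conjTranspose).trace) -
        (a : ℂ) ^ 4 * ∑ v : Fin d → ZMod m,
          (∑ i, ∑ j, MatrixField.curvature A i j (latticePoint a v) ^ 2).trace =
      ∑ i, ∑ j, ∑ v : Fin d → ZMod m, ((plaquetteDefect A i j a (latticePoint a v) *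
          (plaquetteDefect A i j a (latticePoint a v)).conjTranspose).trace -
        (a : ℂ) ^ 4 * (MatrixField.curvature A i j (latticePoint a v) ^ 2).trace) := by
    simp only [Finset.sum_sub_distrib, Matrix.trace_sum, Finset.mul_sum]
    congr 1
    rw [Finset.sum_comm]
    exact Finset.sum_congr rfl fun i _ => Finset.sum_comm
  rw [e, Finset.sum_mul]
  refine norm_sum_le_of_le _ fun i _ => ?_
  rw [Finset.sum_mul]
  refine norm_sum_le_of_le _ fun j _ => ?_
  exact norm_latticeSum_le ha ham (G := fun x => (plaquetteDefect A i j a x *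
    (plaquetteDefect A i j a x).conjTranspose).trace -
      (a : ℂ) ^ 4 * (MatrixField.curvature A i j x ^ 2).trace) fun x => hC i j a x ha haℓ

theorem exists_higgsSum_le (hℓ : 0 < ℓ) {A : Fin d → MatrixField d N} {h : MatrixField d N}
    (hA : ∀ j, IsTorusField ℓ (A j)) (hh : IsTorusField ℓ h) :
    ∃ C, ∀ (m : ℕ) [NeZero m] (a : ℝ), 0 < a → a ≤ ℓ → a * m = ℓ →
      ‖(a : ℂ) ^ 2 * (∑ j, ∑ v : Fin d → ZMod m, (higgsDefect A h j a (latticePoint a v) *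
          (higgsDefect A h j a (latticePoint a v)).conjTranspose).trace) -
        (a : ℂ) ^ 4 * ∑ v : Fin d → ZMod m,
          (∑ j, MatrixField.covDeriv A j h (latticePoint a v) ^ 2).trace‖ ≤
        C * (a ^ 5 * (1 / a) ^ d) := by
  choose C hC using fun j => exists_trace_higgsDefect_le hℓ hA hh j
  refine ⟨∑ j, C j * ℓ ^ d, fun m _ a ha haℓ ham => ?_⟩
  have e : (a : ℂ) ^ 2 * (∑ j, ∑ v : Fin d → ZMod m, (higgsDefect A h j a (latticePoint a v) *
          (higgsDefect A h j a (latticePoint a v)).conjTranspose).trace) -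
        (a : ℂ) ^ 4 * ∑ v : Fin d → ZMod m,
          (∑ j, MatrixField.covDeriv A j h (latticePoint a v) ^ 2).trace =
      ∑ j, ∑ v : Fin d → ZMod m, (a : ℂ) ^ 2 * ((higgsDefect A h j a (latticePoint a v) *
          (higgsDefect A h j a (latticePoint a v)).conjTranspose).trace -
        (a : ℂ) ^ 2 * (MatrixField.covDeriv A j h (latticePoint a v) ^ 2).trace) := by
    simp only [mul_sub, Finset.sum_sub_distrib, Matrix.trace_sum, Finset.mul_sum, ← mul_assoc,
      ← pow_add]
    congr 1
    rw [Finset.sum_comm]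
  rw [e, Finset.sum_mul]
  refine norm_sum_le_of_le _ fun j _ => ?_
  refine norm_latticeSum_le ha ham (G := fun x => (a : ℂ) ^ 2 * ((higgsDefect A h j a x *
    (higgsDefect A h j a x).conjTranspose).trace -
      (a : ℂ) ^ 2 * (MatrixField.covDeriv A j h x ^ 2).trace)) fun x => ?_
  rw [norm_mul, norm_pow, Complex.norm_real, Real.norm_of_nonneg ha.le]
  calc a ^ 2 * _ ≤ a ^ 2 * (C j * a ^ 3) := by gcongr; exact hC j a x ha haℓ
    _ = _ := by ring

/-- The exact lattice spectral action. -/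
theorem blockTrace_aeval_latticeDirac {m : ℕ} [NeZero m] (hm : 5 ≤ m) {a : ℝ} (ham : a * m = ℓ)
    {A : Fin d → MatrixField d N} {h : MatrixField d N}
    (hA : ∀ j, IsTorusField ℓ (A j)) (hh : IsTorusField ℓ h) (f : Polynomial ℝ)
    (hf : f.natDegree ≤ 4) :
    blockTrace (Fin d → ZMod m) (Fin N)
        (Polynomial.aeval (latticeDirac m A h a) (f.map (algebraMap ℝ ℂ))) =
      (m : ℂ) ^ d * N * (f.coeff 0 + 2 * d * f.coeff 2 + (12 * d ^ 2 - 6 * d) * f.coeff 4) -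
      2 * f.coeff 4 * (∑ i, ∑ j, ∑ v : Fin d → ZMod m,
        (plaquetteDefect A i j a (latticePoint a v) *
          (plaquetteDefect A i j a (latticePoint a v)).conjTranspose).trace) -
      2 * f.coeff 4 * ((a : ℂ) ^ 2 * ∑ j, ∑ v : Fin d → ZMod m,
        (higgsDefect A h j a (latticePoint a v) *
          (higgsDefect A h j a (latticePoint a v)).conjTranspose).trace) +
      (f.coeff 2 + 12 * d * f.coeff 4) * ((a : ℂ) ^ 2 *
        ∑ v : Fin d → ZMod m, (h (latticePoint a v) ^ 2).trace) +
      f.coeff 4 * ((a : ℂ) ^ 4 * ∑ v : Fin d → ZMod m, (h (latticePoint a v) ^ 4).trace) +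
      (f.coeff 1 + 6 * d * f.coeff 3) * ((a : ℂ) * ∑ v : Fin d → ZMod m,
        (h (latticePoint a v)).trace) +
      f.coeff 3 * ((a : ℂ) ^ 3 * ∑ v : Fin d → ZMod m, (h (latticePoint a v) ^ 3).trace) := by
  set U : Fin d → (Fin d → ZMod m) → Matrix (Fin N) (Fin N) ℂ :=
    fun j v => linkField A j a (latticePoint a v) with hU
  set y : (Fin d → ZMod m) → Matrix (Fin N) (Fin N) ℂ :=
    fun v => (a : ℂ) • h (latticePoint a v) with hy
  have H := isHoppingTrace hm (U := U) (fun j v => linkField_mem_unitary hA j a _) y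
  have hyH : ∀ v, (y v).IsHermitian := fun v => by
    unfold Matrix.IsHermitian
    rw [hy, Matrix.conjTranspose_smul, (hh.hermitian _).eq]
    simp
  have t1 : blockTrace (Fin d → ZMod m) (Fin N) 1 = (m : ℂ) ^ d * N := by
    rw [← blockShift_one, blockTrace_blockShift, if_pos rfl]
    simp
  have tk : ∀ k : ℕ, blockTrace (Fin d → ZMod m) (Fin N) (blockShift 0 y ^ k) =
      (a : ℂ) ^ k * ∑ v : Fin d → ZMod m, (h (latticePoint a v) ^ k).trace := fun k => by
    rw [blockShift_zero_pow, blockTrace_blockShift, if_pos rfl, Finset.mul_sum]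
    refine Finset.sum_congr rfl fun v _ => ?_
    rw [hy, smul_pow, Matrix.trace_smul, smul_eq_mul]
  have hshift : ∀ i j v, U j (v + Pi.single i 1) =
      linkField A j a (latticePoint a v + Pi.single i a) := fun i j v => by
    simp only [hU, linkField]
    rw [latticePoint_add_single ham (hA j)]
  have tp : ∀ i j, blockTrace (Fin d → ZMod m) (Fin N)
      ((hop U (i, true) * hop U (j, true) - hop U (j, true) * hop U (i, true)) *
        (hop U (j, false) * hop U (i, false) - hop U (i, false) * hop U (j, false))) =
      ∑ v : Fin d → ZMod m, (plaquetteDefect A i j a (latticePoint a v) *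
          (plaquetteDefect A i j a (latticePoint a v)).conjTranspose).trace := fun i j => by
    rw [blockTrace_hop_commutator]
    simp only [hshift]
    rfl
  have th : ∀ j, blockTrace (Fin d → ZMod m) (Fin N)
      ((hop U (j, true) * blockShift 0 y - blockShift 0 y * hop U (j, true)) *
        (blockShift 0 y * hop U (j, false) - hop U (j, false) * blockShift 0 y)) =
      (a : ℂ) ^ 2 * ∑ v : Fin d → ZMod m, (higgsDefect A h j a (latticePoint a v) *
          (higgsDefect A h j a (latticePoint a v)).conjTranspose).trace := fun j => by
    rw [blockTrace_hop_commutator_diagonal U hyH, Finset.mul_sum]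
    refine Finset.sum_congr rfl fun v _ => ?_
    have e : U j v * y (v + Pi.single j 1) - y v * U j v =
        (a : ℂ) • higgsDefect A h j a (latticePoint a v) := by
      simp only [hy, higgsDefect]
      rw [latticePoint_add_single ham hh, mul_smul_comm, smul_mul_assoc, smul_sub]
    rw [e, Matrix.conjTranspose_smul, smul_mul_smul_comm, Matrix.trace_smul, smul_eq_mul]
    simp [sq]
  have hD : latticeDirac m A h a = ∑ σ, hop U σ + blockShift 0 y := rfl
  have p1 : blockTrace (Fin d → ZMod m) (Fin N) (latticeDirac m A h a) =
      (a : ℂ) * ∑ v : Fin d → ZMod m, (h (latticePoint a v)).trace := by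
    have h1 := H.sum_mul_pow 0
    have h2 := tk 1
    simp only [pow_zero, mul_one, pow_one] at h1 h2
    rw [hD, map_add, h1, h2, zero_add]
  have p2 := H.pow_two
  have p3 := H.pow_three
  have p4 := H.pow_four
  have tk1 := tk 1
  simp only [pow_one] at tk1
  simp only [← hD, t1, tk, tp, th, tk1] at p2 p3 p4
  have hdeg : (f.map (algebraMap ℝ ℂ)).natDegree < 5 :=
    lt_of_le_of_lt (Polynomial.natDegree_map_le) (by omega)
  rw [Polynomial.aeval_eq_sum_range' hdeg]
  simp only [Finset.sum_range_succ, Finset.sum_range_zero, zero_add, map_add, map_smul, pow_zero,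
    pow_one, Polynomial.coeff_map, p1, p2, p3, p4, t1, smul_eq_mul, Complex.coe_algebraMap,
    ← Finset.mul_sum]
  ring

end SmoothLimit

theorem mainTheorem8 (d N : ℕ) (hd : 2 ≤ d) (hN : 0 < N) (ℓ : ℝ) (hℓ : 0 < ℓ)
    (f : Polynomial ℝ) (hf : f.natDegree ≤ 4)
    (A : Fin d → MatrixField d N) (h : MatrixField d N)
    (hA : ∀ j, IsTorusField ℓ (A j)) (hh : IsTorusField ℓ h) :
    ∃ (C : ℝ) (m₀ : ℕ), ∀ (m : ℕ) [NeZero m], m₀ ≤ m → ∀ (a Λ : ℝ), a * m = ℓ → Λ = 1 / a →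
      ∀ (R : QuiverRep (LoopedTorus d m)) (v₀ : LoopedTorus d m),
        Nonempty (R.obj v₀ ≅ PrespectralTriple.matrixTriple N) →
        (∀ v, Nonempty (R.obj v ≅ PrespectralTriple.matrixTriple N)) ∧
        ∀ (ρ : EdgeLength (LoopedTorus d m))
          (u : ∀ v, (R.obj v).H ≃ₗᵢ[ℂ] EuclideanSpace ℂ (Fin N)),
          IsLatticeSample a A h R ρ u →
          ‖spectralAction f (R.dirac ρ) Λ -
            ((Λ : ℂ) ^ d * N *
                (f.coeff 0 + 2 * d * f.coeff 2 + (12 * d ^ 2 - 6 * d) * f.coeff 4) * (ℓ : ℂ) ^ d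
              - 2 * (Λ : ℂ) ^ ((d : ℤ) - 4) * f.coeff 4 *
                  MatrixField.integralTrace ℓ
                    (fun x => ∑ i, ∑ j, MatrixField.curvature A i j x ^ 2)
              - 2 * (Λ : ℂ) ^ ((d : ℤ) - 4) * f.coeff 4 *
                  MatrixField.integralTrace ℓ (fun x => ∑ j, MatrixField.covDeriv A j h x ^ 2)
              + (Λ : ℂ) ^ ((d : ℤ) - 2) * (f.coeff 2 + 12 * d * f.coeff 4) *
                  MatrixField.integralTrace ℓ (fun x => h x ^ 2)
              + (Λ : ℂ) ^ ((d : ℤ) - 4) * f.coeff 4 *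
                  MatrixField.integralTrace ℓ (fun x => h x ^ 4)
              + (Λ : ℂ) ^ ((d : ℤ) - 1) * (f.coeff 1 + 6 * d * f.coeff 3) *
                  MatrixField.integralTrace ℓ h
              + (Λ : ℂ) ^ ((d : ℤ) - 3) * f.coeff 3 *
                  MatrixField.integralTrace ℓ (fun x => h x ^ 3))‖
            ≤ C * Λ ^ ((d : ℤ) - 5) := by
  have sA : ∀ j, IsSmoothField ℓ (A j) := fun j => (hA j).isSmoothField
  have sh : IsSmoothField ℓ h := hh.isSmoothField
  have sF : IsSmoothField ℓ fun x => ∑ i, ∑ j, MatrixField.curvature A i j x ^ 2 :=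
    IsSmoothField.sum fun i => IsSmoothField.sum fun j => (IsSmoothField.curvature sA i j).pow 2
  have sD : IsSmoothField ℓ fun x => ∑ j, MatrixField.covDeriv A j h x ^ 2 :=
    IsSmoothField.sum fun j => (IsSmoothField.covDeriv sA sh j).pow 2
  obtain ⟨C₁, hC₁⟩ := exists_latticeSum_le hℓ sh (k := 1) (by omega)
  obtain ⟨C₂, hC₂⟩ := exists_latticeSum_le hℓ (sh.pow 2) (k := 2) (by omega)
  obtain ⟨C₃, hC₃⟩ := exists_latticeSum_le hℓ (sh.pow 3) (k := 3) (by omega)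
  obtain ⟨C₄, hC₄⟩ := exists_latticeSum_le hℓ (sh.pow 4) (k := 4) (by omega)
  obtain ⟨CF, hCF⟩ := exists_latticeSum_le hℓ sF (k := 4) (by omega)
  obtain ⟨CD, hCD⟩ := exists_latticeSum_le hℓ sD (k := 4) (by omega)
  obtain ⟨CP, hCP⟩ := exists_plaquetteSum_le hℓ hA
  obtain ⟨CH, hCH⟩ := exists_higgsSum_le hℓ hA hh
  -- The curvature and Higgs kinetic terms each incur two errors, local expansion and Riemann sum;
  -- each power of h incurs only the latter. The threshold 5 excludes winding.
  refine ⟨‖(-2 * f.coeff 4 : ℂ)‖ * CP + ‖(-2 * f.coeff 4 : ℂ)‖ * CF +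
    ‖(-2 * f.coeff 4 : ℂ)‖ * CH + ‖(-2 * f.coeff 4 : ℂ)‖ * CD +
    ‖(f.coeff 2 + 12 * d * f.coeff 4 : ℂ)‖ * C₂ + ‖(f.coeff 4 : ℂ)‖ * C₄ +
    ‖(f.coeff 1 + 6 * d * f.coeff 3 : ℂ)‖ * C₁ + ‖(f.coeff 3 : ℂ)‖ * C₃, 5, ?_⟩
  intro m _ hm a Λ ham hΛ R v₀ h₀
  refine ⟨fun v => R.nonempty_iso_matrixTriple h₀ v, fun ρ u hS => ?_⟩
  subst hΛ
  have hm0 : (0 : ℝ) < m := Nat.cast_pos.2 (NeZero.pos m)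
  have ha : 0 < a := pos_of_mul_pos_left (ham ▸ hℓ) hm0.le
  have haℓ : a ≤ ℓ := by
    rw [← ham]
    exact le_mul_of_one_le_right ha.le (Nat.one_le_cast.2 (NeZero.pos m))
  rw [hS.spectralAction_eq ha.ne' hA f, blockTrace_aeval_latticeDirac hm ham hA hh f hf]
  have ha' : (a : ℂ) ≠ 0 := Complex.ofReal_ne_zero.2 ha.ne'
  have z : ∀ k : ℕ, ((1 / a : ℝ) : ℂ) ^ ((d : ℤ) - k) =
      (a : ℂ) ^ k * ((1 / a : ℝ) : ℂ) ^ d := fun k => by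
    rw [zpow_sub₀ (by simpa using ha'), zpow_natCast, zpow_natCast]
    push_cast
    simp only [one_div, inv_pow]
    field_simp
  have zr : (1 / a) ^ ((d : ℤ) - 5) = a ^ 5 * (1 / a) ^ d := by
    rw [zpow_sub₀ (by positivity), zpow_natCast, show (5 : ℤ) = ((5 : ℕ) : ℤ) from rfl,
      zpow_natCast]
    field_simp
  have z1 := z 1
  have z2 := z 2
  have z3 := z 3
  have z4 := z 4
  push_cast at z1 z2 z3 z4
  -- The constant term counts vertices, so it equals the volume term exactly and has no Riemann
  -- error.
  have zd : (m : ℂ) ^ d = ((1 / a : ℝ) : ℂ) ^ d * (ℓ : ℂ) ^ d := by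
    rw [← mul_pow, ← ham]
    congr 1
    push_cast
    field_simp
  have hC₁ := hC₁ m a ha haℓ ham
  have hC₂ := hC₂ m a ha haℓ ham
  have hC₃ := hC₃ m a ha haℓ ham
  have hC₄ := hC₄ m a ha haℓ ham
  have hCF := hCF m a ha haℓ ham
  have hCD := hCD m a ha haℓ ham
  have hCP := hCP m a ha haℓ ham
  have hCH := hCH m a ha haℓ ham
  have hn : ∀ (c x : ℂ) (K E : ℝ), ‖x‖ ≤ K * E → ‖c * x‖ ≤ ‖c‖ * K * E := fun c x K E hx => by
    rw [norm_mul, mul_assoc]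
    exact mul_le_mul_of_nonneg_left hx (norm_nonneg c)
  -- The eight errors are added in the order of the chosen constant. The intermediate lattice sums
  -- cancel, so their sum is the difference to be estimated.
  have total := norm_add_le_of_le (norm_add_le_of_le (norm_add_le_of_le (norm_add_le_of_le
    (norm_add_le_of_le (norm_add_le_of_le (norm_add_le_of_le
      (hn (-2 * f.coeff 4) _ _ _ hCP) (hn (-2 * f.coeff 4) _ _ _ hCF))
      (hn (-2 * f.coeff 4) _ _ _ hCH)) (hn (-2 * f.coeff 4) _ _ _ hCD))
      (hn (f.coeff 2 + 12 * d * f.coeff 4) _ _ _ hC₂)) (hn (f.coeff 4) _ _ _ hC₄))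
      (hn (f.coeff 1 + 6 * d * f.coeff 3) _ _ _ hC₁)) (hn (f.coeff 3) _ _ _ hC₃)
  rw [zr]
  simp only [add_mul]
  refine le_trans (le_of_eq (congrArg norm ?_)) total
  push_cast at zd ⊢
  rw [z1, z2, z3, z4, zd]
  ring
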